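/- **Setting and definitions.** Let $M$ be an $m$-dimensional (smooth) Riemannian manifold with inner products $\langle\cdot,\cdot\rangle_x$ and norms $\|\cdot\|_x$ on $T_xM$. A retraction on $M$ is a $C^1$ map $R:TM\to M$ such that, for every $x\in M$, the restriction $R_x=R|_{T_xM}$ satisfies $R_x(\mathbf 0_x)=x$ and $dR_x(\mathbf 0_x)=\mathrm{id}_{T_xM}$. Let $(\Omega,\mu)$ be a probability space. For $f:M\times\Omega\to\mathbb R$ (with $f(x,\cdot)$ measurable for each $x\in M$) write $f_\omega=f(\cdot,\omega)$ and $\nabla_M f(x,\omega)=\nabla f_\omega(x)$. A function $g:M\times\Omega\to\mathbb R$ is *locally bounded* if for every compact $K\subset M$ there is $C_K>0$ with $|g(x,\omega)|\le C_K$ for all $x\in K$, $\omega\in\Omega$. For $f$ differentiable in the $M$-direction (every $f_\omega$ is differentiable), put $f_{x,\omega}=f_\omega\circ R_x:T_xM\to\mathbb R$; $f$ has *locally $R$-Lipschitz gradient* if for every compact $K\subset M$ and every $r>0$ there is $C_{K,r}>0$ with $\|\nabla f_{x,\omega}(\mathbf v)-\nabla f_{x,\omega}(\mathbf 0_x)\|_x\le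 C_{K,r}\|\mathbf v\|_x$ for all $x\in K$, all $\mathbf v\in T_xM$ with $\|\mathbf v\|_x\le r$ and all $\omega\in\Omega$. A *confinement* of $f$ is a differentiable $\rho:M\to\mathbb R$ such that $\{\rho\le\delta\}$ is compact for every $\delta\in\mathbb R$ and, for some $\rho_0\in\mathbb R$, $\langle\nabla\rho(x),\nabla_Mf(x,\omega)\rangle_x\ge0$ for every $\omega\in\Omega$ and every $x\in M$ with $\rho(x)\ge\rho_0$. **Theorem.** Assume that: 1. $R$ is a $C^2$ retraction on $M$; 2. $f:M\times\Omega\to\mathbb R$ is differentiable in the $M$-direction, $f$ and $\|\nabla_Mf\|$ are locally bounded, and $f$ has locally $R$-Lipschitz gradient; $F(x)=\int_\Omega f(x,\omega)\,d\mu$; 3. $\rho$ is a $C^2$ confinement of $f$, and $\rho_0\in\mathbb R$ is such that $\langle\nabla\rho(x),\nabla_M f(x,\omega)\rangle_x\ge0$ for every $\omega\in\Omega$ and every $x$ with $\rho(x)\ge\rho_0$; 4. $\{\omega_t\}_{t\ge0}$ are independent $\Omega$-valued random variables with common law $\mu$; 5. $a,b,\Theta>0$, $c_t>0$ with $\sum_tc_t=\infty$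 and $\sum_tc_t^2<\infty$; $c=\max_tc_t$, $\sigma=\sum_tc_t^2$, $\rho_1=\rho_0+ca+\frac{b^2\sigma}2$; 6. $x_0\in M$ is a fixed point with $\rho(x_0)\le\rho_0$. Let $\{x_t\}_{t\ge 0}$ be a sequence of random elements of $M$ and $\{\varphi_t\}_{t\ge 0}$ a sequence of random positive numbers such that, for all $t\ge0$, $$x_{t+1}=R_{x_t}\Big(-\frac{c_t}{\varphi_t}\nabla_Mf(x_t,\omega_t)\Big),\qquad \varphi_t\ge\max\Big\{A_t,B_t,\frac{c_t}{\Theta}\Big\},$$ where $$A_t=\frac1a\sup_{\omega\in\Omega}\max\{0,-\langle\nabla\rho(x_t),\nabla_Mf(x_t,\omega)\rangle_{x_t}\},$$ $$B_t=\frac1b\sup_{|\theta|\le\Theta,\ \omega\in\Omega}\sqrt{\max\{0,\ \mathrm{Hess}(\rho\circ R_{x_t})|_{\theta\nabla_Mf(x_t,\omega)}(\nabla_Mf(x_t,\omega),\nabla_Mf(x_t,\omega))\}},$$ and $\mathrm{Hess}(\rho\circ R_x)$ is the Hessian on the inner product space $T_xM$. Then * $\{x_t\}$ is contained in the set $\{x\in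 M:\rho(x)\le\rho_1\}$, which is compact; in particular it has convergent subsequences. Assume moreover that * (a) for every $t\ge0$, the data $(\varphi_0,\dots,\varphi_t,\omega_0,\dots,\omega_{t-1})$ available when step $t$ is taken are jointly independent of the present and future samples $\{\omega_\tau\}_{\tau\ge t}$ (this holds for instance if every $\varphi_t$ is a function of $\omega_0,\dots,\omega_{t-1}$); * (b) there are $\Phi_{\min},\Phi_{\max}>0$ with $\Phi_{\min}\le\varphi_t\le\Phi_{\max}$ for all $t\ge0$. Then $f(x,\cdot)$ is integrable for every $x \in M$, $F$ is differentiable on $M$, and * $\{F(x_t)\}$ converges almost surely to a finite number; * $\|\nabla F(x_t)\|_{x_t}\to0$ almost surely; * almost surely, every limit point of $\{x_t\}$ is a stationary point of $F$. -/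

import Mathlib

open MeasureTheory ProbabilityTheory Filter Topology Bundle
open scoped Manifold ContDiff

/-- Tangent spaces of a finite-dimensional Riemannian manifold are complete
for the norm of the Riemannian inner product. -/
instance tangentSpaceComplete {m : ℕ} {M : Type*} [TopologicalSpace M]
    [ChartedSpace (EuclideanSpace ℝ (Fin m)) M]
    [RiemannianBundle (fun x : M => TangentSpace (𝓡 m) x)] (x : M) :
    CompleteSpace (TangentSpace (𝓡 m) x) :=
  haveI : FiniteDimensional ℝ (TangentSpace (𝓡 m) x) :=
    inferInstanceAs (FiniteDimensional ℝ (EuclideanSpace ℝ (Fin m)))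
  FiniteDimensional.complete ℝ _

namespace ConfinedSGD

section Defs

variable {m : ℕ} {M : Type*} [TopologicalSpace M]
  [ChartedSpace (EuclideanSpace ℝ (Fin m)) M]

/-- A `C¹` retraction `R : TM → M`: `R_x(0_x) = x` and the differential at `0_x` of
`R_x : T_x M → M` is the identity of `T_x M`. -/
structure IsRetraction [IsManifold (𝓡 m) ∞ M]
    [RiemannianBundle (fun x : M => TangentSpace (𝓡 m) x)]
    (R : TangentBundle (𝓡 m) M → M) : Prop where
  contMDiff : ContMDiff (𝓡 m).tangent (𝓡 m) 1 R
  map_zero : ∀ x : M, R ⟨x, 0⟩ = x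
  mfderiv_zero : ∀ x : M,
    mfderiv 𝓘(ℝ, TangentSpace (𝓡 m) x) (𝓡 m)
      (fun v : TangentSpace (𝓡 m) x => R ⟨x, v⟩) 0
      = ContinuousLinearMap.id ℝ (TangentSpace (𝓡 m) x)

/-- The Riemannian gradient of `h : M → ℝ` at `x`: the vector of `T_x M` dual to `dh_x`. -/
noncomputable def rgrad [RiemannianBundle (fun x : M => TangentSpace (𝓡 m) x)]
    (h : M → ℝ) (x : M) : TangentSpace (𝓡 m) x :=
  (InnerProductSpace.toDual ℝ (TangentSpace (𝓡 m) x)).symm (mfderiv (𝓡 m) 𝓘(ℝ, ℝ) h x)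

/-- A random function `f : M × Ω → ℝ` is locally bounded on `M`. -/
def LocallyBounded {Ω : Type*} (f : M → Ω → ℝ) : Prop :=
  ∀ K : Set M, IsCompact K → ∃ C : ℝ, 0 < C ∧ ∀ x ∈ K, ∀ ξ : Ω, |f x ξ| ≤ C

/-- `f` is first-order differentiable in the `M`-direction. -/
def DifferentiableInM {Ω : Type*} (f : M → Ω → ℝ) : Prop :=
  ∀ ξ : Ω, MDifferentiable (𝓡 m) 𝓘(ℝ, ℝ) (fun x => f x ξ)

/-- `f` has locally `R`-Lipschitz gradient in the `M`-direction; the gradient is that of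
`v ↦ f (R_x v, ξ)` on the inner product space `T_x M`. -/
def LocallyRLipschitzGradient [RiemannianBundle (fun x : M => TangentSpace (𝓡 m) x)]
    {Ω : Type*} (R : TangentBundle (𝓡 m) M → M) (f : M → Ω → ℝ) : Prop :=
  ∀ K : Set M, IsCompact K → ∀ r : ℝ, 0 < r → ∃ C : ℝ, 0 < C ∧
    ∀ x ∈ K, ∀ v : TangentSpace (𝓡 m) x, ‖v‖ ≤ r → ∀ ξ : Ω,
      ‖gradient (fun w : TangentSpace (𝓡 m) x => f (R ⟨x, w⟩) ξ) v
        - gradient (fun w : TangentSpace (𝓡 m) x => f (R ⟨x, w⟩) ξ) 0‖ ≤ C * ‖v‖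

/-- The gradients of `ρ` and of all `f (·, ξ)` make a nonnegative inner product
where `ρ ≥ ρ₀`. -/
def GradientsAlignedAbove [RiemannianBundle (fun x : M => TangentSpace (𝓡 m) x)]
    {Ω : Type*} (f : M → Ω → ℝ) (ρ : M → ℝ) (ρ₀ : ℝ) : Prop :=
  ∀ (ξ : Ω) (x : M), ρ₀ ≤ ρ x →
    0 ≤ inner ℝ (rgrad (m := m) ρ x) (rgrad (m := m) (fun y => f y ξ) x)

/-- `ρ` is a confinement of the random function `f` on `M`. -/
structure IsConfinement [RiemannianBundle (fun x : M => TangentSpace (𝓡 m) x)]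
    {Ω : Type*} (f : M → Ω → ℝ) (ρ : M → ℝ) : Prop where
  differentiable : MDifferentiable (𝓡 m) 𝓘(ℝ, ℝ) ρ
  isCompact_sublevel : ∀ δ : ℝ, IsCompact {x : M | ρ x ≤ δ}
  exists_level : ∃ ρ₀ : ℝ, GradientsAlignedAbove (m := m) f ρ ρ₀

/-- `Hess(h ∘ R_x)|_u (v, v)`, the second derivative on the vector space `T_x M`. -/
noncomputable def hessR [RiemannianBundle (fun x : M => TangentSpace (𝓡 m) x)]
    (R : TangentBundle (𝓡 m) M → M) (h : M → ℝ) (x : M) (u v : TangentSpace (𝓡 m) x) : ℝ :=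
  fderiv ℝ (fderiv ℝ (fun w : TangentSpace (𝓡 m) x => h (R ⟨x, w⟩))) u v v

/-- The quantity `A_t`, at `x = x_t`. -/
noncomputable def stepBoundA [RiemannianBundle (fun x : M => TangentSpace (𝓡 m) x)]
    {Ω : Type*} (f : M → Ω → ℝ) (ρ : M → ℝ) (a : ℝ) (x : M) : ℝ :=
  1 / a * sSup {r : ℝ | ∃ ξ : Ω,
    r = max 0 (-inner ℝ (rgrad (m := m) ρ x) (rgrad (m := m) (fun y => f y ξ) x))}

/-- The quantity `B_t`, at `x = x_t`. -/
noncomputable def stepBoundB [RiemannianBundle (fun x : M => TangentSpace (𝓡 m) x)]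
    {Ω : Type*} (R : TangentBundle (𝓡 m) M → M) (f : M → Ω → ℝ) (ρ : M → ℝ)
    (b Θ : ℝ) (x : M) : ℝ :=
  1 / b * sSup {r : ℝ | ∃ (θ : ℝ) (ξ : Ω), |θ| ≤ Θ ∧
    r = √(max 0 (hessR R ρ x (θ • rgrad (m := m) (fun y => f y ξ) x)
      (rgrad (m := m) (fun y => f y ξ) x)))}

/-- `x` is a stationary point of `F`. -/
def IsStationary [RiemannianBundle (fun x : M => TangentSpace (𝓡 m) x)]
    (F : M → ℝ) (x : M) : Prop :=
  MDifferentiableAt (𝓡 m) 𝓘(ℝ, ℝ) F x ∧ rgrad (m := m) F x = 0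

end Defs

end ConfinedSGD

/-! Confinement is a pathwise Taylor estimate for `ρ ∘ R_x` along one step of size `τ = c/φ`. The
second-order term is at most `(bφ)² τ² / 2 = b² c² / 2`, because `φ` dominates `B_t` and `τ ≤ Θ`.
The first-order term is `-τ ⟨∇ρ, ∇f⟩`: it is nonpositive where `ρ ≥ ρ₀`, and at most `τ a φ = c a`
anywhere because `φ` dominates `A_t`. Hence a step from above level `ρ₀` costs only `b² c² / 2`, a
step from below it ends under `ρ₀ + ca + b² c² / 2`, and summing gives `ρ₁` (`confinement_step`,
`confinement_iterates`).

On the resulting compact set `K` the mean `F` has a quadratic expansion along `R`, uniform in the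
base point (`mean_expansion`). Its linear term is `-τ df_ω(∇F)`. Given the past, `x_t` and `φ_t` are
known and `ω_t` is fresh, so the conditional drift of `F(x_t)` is at most `-τ ‖∇F‖² + O(c_t²)`. In
the Doob decomposition the martingale part has increments `O(c_t)` and converges by `L²`
boundedness. Since `F` is bounded on `K`, the predictable part then converges too and `∑ c_t
‖∇F(x_t)‖² < ∞` (`ae_tendsto_and_summable_iterates`).

The passage from this sum to `‖∇F(x_t)‖ → 0` uses only continuity of `‖∇F‖`. If `∇F(y) ≠ 0` at a
cluster point `y`, take a `C¹` bump at `y` supported where `‖∇F‖` is bounded below. The bump changes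
by `O(c_t)` per step, while the total of `c_t` spent in its support after a late time is small. So
the sequence, once near `y`, never leaves the support, and `∑ c_t < ∞`, a contradiction
(`not_mapClusterPt_of_bump`). Thus every cluster point is stationary, and compactness of `K` yields
the limit. -/

namespace ConfinedSGD

/-! ### Gradients and pullbacks to a single tangent space. -/

section Fiber

variable {m : ℕ} {M : Type*} [TopologicalSpace M]
  [ChartedSpace (EuclideanSpace ℝ (Fin m)) M]

theorem finiteDimensional_tangentSpace (x : M) :
    FiniteDimensional ℝ (TangentSpace (𝓡 m) x) :=
  inferInstanceAs (FiniteDimensional ℝ (EuclideanSpace ℝ (Fin m)))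

variable [RiemannianBundle (fun x : M => TangentSpace (𝓡 m) x)]

/-- The differential of a real function on `M`, as an element of the dual of the tangent space. -/
noncomputable def differential (h : M → ℝ) (x : M) : StrongDual ℝ (TangentSpace (𝓡 m) x) :=
  mfderiv (𝓡 m) 𝓘(ℝ, ℝ) h x

theorem rgrad_eq (h : M → ℝ) (x : M) :
    rgrad (m := m) h x
      = (InnerProductSpace.toDual ℝ (TangentSpace (𝓡 m) x)).symm (differential h x) := rfl

theorem inner_rgrad (h : M → ℝ) (x : M) (v : TangentSpace (𝓡 m) x) :
    inner ℝ (rgrad (m := m) h x) v = differential h x v := by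
  rw [rgrad_eq, InnerProductSpace.toDual_symm_apply]

theorem norm_differential (h : M → ℝ) (x : M) :
    ‖differential (m := m) h x‖ = ‖rgrad (m := m) h x‖ := by
  rw [rgrad_eq, LinearIsometryEquiv.norm_map]

theorem eq_rgrad_of_inner {h : M → ℝ} {x : M} {w : TangentSpace (𝓡 m) x}
    (hw : ∀ v : TangentSpace (𝓡 m) x, inner ℝ w v = differential h x v) :
    w = rgrad (m := m) h x :=
  ext_inner_right ℝ fun v => by rw [hw v, inner_rgrad]

theorem rgrad_const_mul (r : ℝ) {h : M → ℝ} {x : M}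
    (hh : MDifferentiableAt (𝓡 m) 𝓘(ℝ, ℝ) h x) :
    rgrad (m := m) (fun y => r * h y) x = r • rgrad (m := m) h x := by
  refine (eq_rgrad_of_inner fun v => ?_).symm
  have e := const_smul_mfderiv hh r
  rw [inner_smul_left, inner_rgrad]
  exact (congrArg (fun L => L v) e).symm

variable [IsManifold (𝓡 m) ∞ M]

/-- The inclusion of a tangent space into the tangent bundle is smooth. -/
theorem contMDiff_fiberInclusion (x : M) {n : WithTop ℕ∞} :
    ContMDiff 𝓘(ℝ, TangentSpace (𝓡 m) x) (𝓡 m).tangent n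
      (fun v : TangentSpace (𝓡 m) x => (⟨x, v⟩ : TangentBundle (𝓡 m) M)) := by
  intro v
  rw [contMDiffAt_totalSpace]
  refine ⟨contMDiffAt_const, ?_⟩
  have h := ((trivializationAt (EuclideanSpace ℝ (Fin m)) (TangentSpace (𝓡 m)) x).continuousLinearMapAt
    ℝ x).contMDiff (n := n) v
  refine h.congr_of_eventuallyEq (Eventually.of_forall fun w => ?_)
  exact (Trivialization.continuousLinearMapAt_apply_of_mem ℝ
    (trivializationAt (EuclideanSpace ℝ (Fin m)) (TangentSpace (𝓡 m)) x)
    (FiberBundle.mem_baseSet_trivializationAt' x) w).symm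

theorem contMDiff_comp_fiberInclusion {R : TangentBundle (𝓡 m) M → M} {n : WithTop ℕ∞}
    (hR : ContMDiff (𝓡 m).tangent (𝓡 m) n R) (x : M) :
    ContMDiff 𝓘(ℝ, TangentSpace (𝓡 m) x) (𝓡 m) n
      (fun v : TangentSpace (𝓡 m) x => R ⟨x, v⟩) :=
  hR.comp (contMDiff_fiberInclusion x)

theorem contDiff_pullback {R : TangentBundle (𝓡 m) M → M} {n : WithTop ℕ∞}
    (hR : ContMDiff (𝓡 m).tangent (𝓡 m) n R) {h : M → ℝ}
    (hh : ContMDiff (𝓡 m) 𝓘(ℝ, ℝ) n h) (x : M) :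
    ContDiff ℝ n (fun v : TangentSpace (𝓡 m) x => h (R ⟨x, v⟩)) :=
  (hh.comp (contMDiff_comp_fiberInclusion hR x)).contDiff

theorem differentiable_pullback {R : TangentBundle (𝓡 m) M → M} (hR : IsRetraction R)
    {h : M → ℝ} (hh : MDifferentiable (𝓡 m) 𝓘(ℝ, ℝ) h) (x : M) :
    Differentiable ℝ (fun v : TangentSpace (𝓡 m) x => h (R ⟨x, v⟩)) :=
  (hh.comp ((contMDiff_comp_fiberInclusion hR.contMDiff x).mdifferentiable
    one_ne_zero)).differentiable

theorem fderiv_pullback_zero {R : TangentBundle (𝓡 m) M → M} (hR : IsRetraction R)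
    {h : M → ℝ} {x : M} (hh : MDifferentiableAt (𝓡 m) 𝓘(ℝ, ℝ) h x) :
    fderiv ℝ (fun v : TangentSpace (𝓡 m) x => h (R ⟨x, v⟩)) 0
      = differential h x := by
  have e := mfderiv_comp (I := 𝓘(ℝ, TangentSpace (𝓡 m) x)) (I' := 𝓡 m) (I'' := 𝓘(ℝ, ℝ))
    (0 : TangentSpace (𝓡 m) x) (g := h) (f := fun v : TangentSpace (𝓡 m) x => R ⟨x, v⟩)
    (by simpa [hR.map_zero x] using hh)
    ((contMDiff_comp_fiberInclusion hR.contMDiff x).mdifferentiable one_ne_zero _)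
  rw [hR.mfderiv_zero x] at e
  rw [← mfderiv_eq_fderiv]
  refine Eq.trans e ?_
  -- The chain rule places the differential of `h` at `R ⟨x, 0⟩`, which equals `x` only
  -- propositionally. All tangent spaces unfold to the same model space, so the base point can be
  -- replaced by substitution.
  have key : ∀ y : M, y = x → ∀ v : EuclideanSpace ℝ (Fin m),
      mfderiv (𝓡 m) 𝓘(ℝ, ℝ) h y v = mfderiv (𝓡 m) 𝓘(ℝ, ℝ) h x v := by
    rintro _ rfl _
    rfl
  ext v
  exact key _ (hR.map_zero x) v

end Fiber

/-! ### Confinement of the iterates by a Taylor bound. -/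

section Confinement

/-- Second-order Taylor bound on an interval `[0, s]`. -/
theorem le_taylor_two {γ γ' γ'' : ℝ → ℝ} {s K : ℝ} (hs : 0 ≤ s)
    (h1 : ∀ t, HasDerivAt γ (γ' t) t) (h2 : ∀ t, HasDerivAt γ' (γ'' t) t)
    (hK : ∀ t ∈ Set.Icc 0 s, γ'' t ≤ K) :
    γ s ≤ γ 0 + γ' 0 * s + K * s ^ 2 / 2 := by
  have hγ' : ∀ t ∈ Set.Icc 0 s, γ' t ≤ γ' 0 + K * t := by
    intro t ht
    refine image_le_of_deriv_right_le_deriv_boundary (a := 0) (b := s) (f := γ') (f' := γ'')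
      (B := fun t => γ' 0 + K * t) (B' := fun _ => K)
      (fun t _ => (h2 t).continuousAt.continuousWithinAt)
      (fun t _ => (h2 t).hasDerivWithinAt) (by simp) (by fun_prop) (fun t _ => ?_)
      (fun t ht => hK t ⟨ht.1, ht.2.le⟩) ht
    simpa using (((hasDerivAt_id t).const_mul K).const_add (γ' 0)).hasDerivWithinAt
  refine image_le_of_deriv_right_le_deriv_boundary (a := 0) (b := s) (f := γ) (f' := γ')
      (B := fun t => γ 0 + γ' 0 * t + K * t ^ 2 / 2) (B' := fun t => γ' 0 + K * t)
      (fun t _ => (h1 t).continuousAt.continuousWithinAt)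
      (fun t _ => (h1 t).hasDerivWithinAt) (by simp) (by fun_prop) (fun t _ => ?_)
      (fun t ht => hγ' t ⟨ht.1, ht.2.le⟩) (Set.right_mem_Icc.2 hs)
  refine HasDerivAt.hasDerivWithinAt ?_
  have e := (((hasDerivAt_id t).const_mul (γ' 0)).const_add (γ 0)).add
    ((((hasDerivAt_id t).pow 2).const_mul K).div_const 2)
  refine (e.congr_deriv (by simp; ring)).congr_of_eventuallyEq (Eventually.of_forall fun u => ?_)
  simp

/-- Second-order Taylor bound along a line in a normed space. -/
theorem le_taylor_two_line {V : Type*} [NormedAddCommGroup V] [NormedSpace ℝ V] {g : V → ℝ}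
    (hg : ContDiff ℝ 2 g) (v : V) {s K : ℝ} (hs : 0 ≤ s)
    (hK : ∀ t ∈ Set.Icc 0 s, fderiv ℝ (fderiv ℝ g) (-t • v) v v ≤ K) :
    g (-s • v) ≤ g 0 - s * fderiv ℝ g 0 v + K * s ^ 2 / 2 := by
  have hl : ∀ t : ℝ, HasDerivAt (fun t : ℝ => -t • v) (-v) t := fun t => by
    simpa using (hasDerivAt_id t).neg.smul_const v
  have hg1 : Differentiable ℝ g := hg.differentiable two_ne_zero
  have hg2 : Differentiable ℝ (fderiv ℝ g) :=
    (hg.fderiv_right (m := 1) (by norm_num)).differentiable one_ne_zero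
  have h1 : ∀ t : ℝ, HasDerivAt (fun t : ℝ => g (-t • v)) (-fderiv ℝ g (-t • v) v) t := fun t => by
    rw [← map_neg]
    exact (hg1 (-t • v)).hasFDerivAt.comp_hasDerivAt t (hl t)
  have h2 : ∀ t : ℝ, HasDerivAt (fun t : ℝ => -fderiv ℝ g (-t • v) v)
      (fderiv ℝ (fderiv ℝ g) (-t • v) v v) t := fun t => by
    have e : HasDerivAt (fun t : ℝ => fderiv ℝ g (-t • v)) (fderiv ℝ (fderiv ℝ g) (-t • v) (-v)) t :=
      (hg2 (-t • v)).hasFDerivAt.comp_hasDerivAt t (hl t)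
    have e' := (e.clm_apply (hasDerivAt_const t v)).neg
    refine e'.congr_deriv ?_
    rw [map_zero, add_zero, map_neg, neg_apply, neg_neg]
  have := le_taylor_two hs h1 h2 hK
  simp only [neg_zero, zero_smul] at this
  linarith

theorem exists_bound_fderiv_fderiv {V : Type*} [NormedAddCommGroup V] [NormedSpace ℝ V]
    [FiniteDimensional ℝ V] {g : V → ℝ} (hg : ContDiff ℝ 2 g) (r C : ℝ) :
    ∃ D, ∀ v w : V, ‖v‖ ≤ r → ‖w‖ ≤ C → fderiv ℝ (fderiv ℝ g) v w w ≤ D := by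
  have : ProperSpace V := FiniteDimensional.proper ℝ _
  obtain ⟨D, hD⟩ := (isCompact_closedBall (0 : V) r).exists_bound_of_continuousOn
    ((hg.fderiv_right (m := 1) (by norm_num)).continuous_fderiv one_ne_zero).continuousOn
  refine ⟨D * C * C, fun v w hv hw => ?_⟩
  have hD' := hD v (by simpa using hv)
  have hD0 : 0 ≤ D := (norm_nonneg _).trans hD'
  have hC0 : 0 ≤ C := (norm_nonneg _).trans hw
  refine (Real.le_norm_self _).trans ((ContinuousLinearMap.le_opNorm₂ _ _ _).trans ?_)
  gcongr

variable {m : ℕ} {M : Type*} [TopologicalSpace M]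
  [ChartedSpace (EuclideanSpace ℝ (Fin m)) M]
  [RiemannianBundle (fun x : M => TangentSpace (𝓡 m) x)]
  {Ω : Type*} {R : TangentBundle (𝓡 m) M → M} {f : M → Ω → ℝ} {ρ : M → ℝ} {a b Θ : ℝ}

/-- A real `sSup` over an unbounded set is `0`, so control of each `ξ` requires boundedness of the
set. This comes from Cauchy–Schwarz and local boundedness of the gradients on the compact set `{x}`.
-/
theorem neg_inner_le_of_stepBoundA_le (ha : 0 < a)
    (hf : LocallyBounded (fun x ξ => ‖rgrad (m := m) (fun y => f y ξ) x‖)) {x : M} {φ : ℝ}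
    (hφ : stepBoundA (m := m) f ρ a x ≤ φ) (ξ : Ω) :
    -inner ℝ (rgrad (m := m) ρ x) (rgrad (m := m) (fun y => f y ξ) x) ≤ a * φ := by
  obtain ⟨C, hC, hb⟩ := hf {x} isCompact_singleton
  have hbdd : BddAbove {r : ℝ | ∃ ξ : Ω,
      r = max 0 (-inner ℝ (rgrad (m := m) ρ x) (rgrad (m := m) (fun y => f y ξ) x))} := by
    refine ⟨‖rgrad (m := m) ρ x‖ * C, ?_⟩
    rintro _ ⟨ζ, rfl⟩
    refine max_le (by positivity) ?_
    refine (neg_le_abs _).trans ((abs_real_inner_le_norm _ _).trans ?_)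
    gcongr
    simpa using hb x rfl ζ
  have h1 := le_csSup hbdd ⟨ξ, rfl⟩
  have h2 : sSup {r : ℝ | ∃ ξ : Ω,
      r = max 0 (-inner ℝ (rgrad (m := m) ρ x) (rgrad (m := m) (fun y => f y ξ) x))} ≤ a * φ := by
    rw [stepBoundA, one_div, inv_mul_le_iff₀ ha] at hφ
    exact hφ
  exact (le_max_right _ _).trans (h1.trans h2)

variable [IsManifold (𝓡 m) ∞ M]

/-- Again the supremum must be shown to be genuine: the points `θ • ∇f` stay in a ball of radius `Θ
C`, on which the second derivative of the `C²` pullback is bounded by compactness. -/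
theorem hessR_le_of_stepBoundB_le (hb : 0 < b) (hΘ : 0 < Θ)
    (hR2 : ContMDiff (𝓡 m).tangent (𝓡 m) 2 R) (hρ2 : ContMDiff (𝓡 m) 𝓘(ℝ, ℝ) 2 ρ)
    (hf : LocallyBounded (fun x ξ => ‖rgrad (m := m) (fun y => f y ξ) x‖)) {x : M} {φ : ℝ}
    (hφ : stepBoundB R f ρ b Θ x ≤ φ) (ξ : Ω) {θ : ℝ} (hθ : |θ| ≤ Θ) :
    hessR R ρ x (θ • rgrad (m := m) (fun y => f y ξ) x) (rgrad (m := m) (fun y => f y ξ) x)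
      ≤ (b * φ) ^ 2 := by
  obtain ⟨C, hC, hbd⟩ := hf {x} isCompact_singleton
  have hbd' : ∀ ζ, ‖rgrad (m := m) (fun y => f y ζ) x‖ ≤ C := fun ζ => by simpa using hbd x rfl ζ
  have : FiniteDimensional ℝ (TangentSpace (𝓡 m) x) := finiteDimensional_tangentSpace x
  obtain ⟨D, hD⟩ := exists_bound_fderiv_fderiv (contDiff_pullback hR2 hρ2 x) (Θ * C) C
  have hbdd : BddAbove {r : ℝ | ∃ (θ : ℝ) (ξ : Ω), |θ| ≤ Θ ∧
      r = √(max 0 (hessR R ρ x (θ • rgrad (m := m) (fun y => f y ξ) x)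
      (rgrad (m := m) (fun y => f y ξ) x)))} := by
    refine ⟨√(max 0 D), ?_⟩
    rintro _ ⟨η, ζ, hη, rfl⟩
    refine Real.sqrt_le_sqrt (max_le_max le_rfl ?_)
    have hmem : ‖η • rgrad (m := m) (fun y => f y ζ) x‖ ≤ Θ * C := by
      rw [norm_smul, Real.norm_eq_abs]
      exact mul_le_mul hη (hbd' ζ) (norm_nonneg _) hΘ.le
    exact hD _ _ hmem (hbd' ζ)
  have h1 := le_csSup hbdd ⟨θ, ξ, hθ, rfl⟩
  rw [stepBoundB, one_div, inv_mul_le_iff₀ hb] at hφ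
  have h2 := h1.trans hφ
  have h0 : 0 ≤ b * φ := (Real.sqrt_nonneg _).trans h2
  rw [Real.sqrt_le_left h0] at h2
  exact (le_max_right _ _).trans h2

/-- One step of the iteration raises the confinement by at most `b² c² / 2` above level `ρ₀`, and
never beyond `ρ₀ + c a + b² c² / 2` from below that level. -/
theorem confinement_step (ha : 0 < a) (hb : 0 < b) (hΘ : 0 < Θ) (hR : IsRetraction R)
    (hR2 : ContMDiff (𝓡 m).tangent (𝓡 m) 2 R) (hρ2 : ContMDiff (𝓡 m) 𝓘(ℝ, ℝ) 2 ρ)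
    (hf : LocallyBounded (fun x ξ => ‖rgrad (m := m) (fun y => f y ξ) x‖))
    {ρ₀ : ℝ} (hρ₀ : GradientsAlignedAbove (m := m) f ρ ρ₀) {x : M} {φ c : ℝ} (hc : 0 < c)
    (hφ : max (max (stepBoundA (m := m) f ρ a x) (stepBoundB R f ρ b Θ x)) (c / Θ) ≤ φ) (ξ : Ω) :
    ρ (R ⟨x, -(c / φ) • rgrad (m := m) (fun y => f y ξ) x⟩)
      ≤ max (ρ x) (ρ₀ + c * a) + b ^ 2 * c ^ 2 / 2 := by
  have hA := ((le_max_left _ _).trans (le_max_left _ _)).trans hφ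
  have hB := ((le_max_right _ _).trans (le_max_left _ _)).trans hφ
  have hT := (le_max_right _ _).trans hφ
  have hφ0 : 0 < φ := (div_pos hc hΘ).trans_le hT
  have hs0 : 0 ≤ c / φ := by positivity
  have hsΘ : c / φ ≤ Θ := by
    rw [div_le_iff₀ hφ0]
    rwa [div_le_iff₀' hΘ] at hT
  have key := le_taylor_two_line (contDiff_pullback hR2 hρ2 x)
    (rgrad (m := m) (fun y => f y ξ) x) hs0 (K := (b * φ) ^ 2) fun t ht =>
      hessR_le_of_stepBoundB_le hb hΘ hR2 hρ2 hf hB ξ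
        (by rw [abs_neg, abs_of_nonneg ht.1]; exact ht.2.trans hsΘ)
  rw [fderiv_pullback_zero hR (hρ2.mdifferentiable two_ne_zero x), ← inner_rgrad,
    hR.map_zero] at key
  -- The factor `φ` cancels, so the second-order cost of a step does not depend on the random step
  -- size.
  have e : (b * φ) ^ 2 * (c / φ) ^ 2 / 2 = b ^ 2 * c ^ 2 / 2 := by field_simp
  rw [e] at key
  refine key.trans (add_le_add_left ?_ _)
  -- At or above `ρ₀` the alignment of the gradients discards the linear term; below it the bound
  -- from `A_t` turns that term into `c a`.
  rcases le_or_gt ρ₀ (ρ x) with h | h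
  · exact le_max_of_le_left (by have := mul_nonneg hs0 (hρ₀ ξ x h); linarith)
  · refine le_max_of_le_right ?_
    have h1 := mul_le_mul_of_nonneg_left (neg_inner_le_of_stepBoundA_le ha hf hA ξ) hs0
    have h2 : c / φ * (a * φ) = c * a := by field_simp
    linarith

/-- The iterates stay in the sublevel set `ρ ≤ ρ₁`. -/
theorem confinement_iterates (ha : 0 < a) (hb : 0 < b) (hΘ : 0 < Θ) (hR : IsRetraction R)
    (hR2 : ContMDiff (𝓡 m).tangent (𝓡 m) 2 R) (hρ2 : ContMDiff (𝓡 m) 𝓘(ℝ, ℝ) 2 ρ)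
    (hf : LocallyBounded (fun x ξ => ‖rgrad (m := m) (fun y => f y ξ) x‖))
    {ρ₀ : ℝ} (hρ₀ : GradientsAlignedAbove (m := m) f ρ ρ₀)
    {c : ℕ → ℝ} (hc_pos : ∀ t, 0 < c t) (hc_sq : Summable (fun t => c t ^ 2))
    {x : ℕ → M} {φ : ℕ → ℝ} {ξ : ℕ → Ω} (hx₀ : ρ (x 0) ≤ ρ₀)
    (hx_succ : ∀ t, x (t + 1) = R ⟨x t,
      -(c t / φ t) • rgrad (m := m) (fun y => f y (ξ t)) (x t)⟩)
    (hφ : ∀ t, max (max (stepBoundA (m := m) f ρ a (x t)) (stepBoundB R f ρ b Θ (x t)))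
      (c t / Θ) ≤ φ t) (t : ℕ) :
    ρ (x t) ≤ ρ₀ + (⨆ t, c t) * a + b ^ 2 * (∑' t, c t ^ 2) / 2 := by
  -- Square summability gives `c t ≤ √σ`, so the real-valued supremum of `c` is a true upper bound.
  have hbdd : BddAbove (Set.range c) := by
    refine ⟨√(∑' t, c t ^ 2), ?_⟩
    rintro _ ⟨t, rfl⟩
    exact Real.le_sqrt_of_sq_le (hc_sq.le_tsum t fun _ _ => sq_nonneg _)
  have hsup : ∀ t, c t ≤ ⨆ t, c t := le_ciSup hbdd
  have h0 : 0 ≤ (⨆ t, c t) * a := mul_nonneg ((hc_pos 0).le.trans (hsup 0)) ha.le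
  have key : ∀ t, ρ (x t) ≤ ρ₀ + (⨆ t, c t) * a + b ^ 2 * (∑ s ∈ Finset.range t, c s ^ 2) / 2 := by
    intro t
    induction t with
    | zero => simp; linarith
    | succ t ih =>
      rw [hx_succ t, Finset.sum_range_succ]
      refine (confinement_step ha hb hΘ hR hR2 hρ2 hf hρ₀ (hc_pos t) (hφ t) (ξ t)).trans ?_
      have h1 : max (ρ (x t)) (ρ₀ + c t * a)
          ≤ ρ₀ + (⨆ t, c t) * a + b ^ 2 * (∑ s ∈ Finset.range t, c s ^ 2) / 2 := by
        refine max_le ih ?_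
        have : 0 ≤ ∑ s ∈ Finset.range t, c s ^ 2 := Finset.sum_nonneg fun _ _ => sq_nonneg _
        have h2 := mul_le_mul_of_nonneg_right (hsup t) ha.le
        have : 0 ≤ b ^ 2 * (∑ s ∈ Finset.range t, c s ^ 2) / 2 := by positivity
        linarith
      linarith
  refine (key t).trans ?_
  have := hc_sq.sum_le_tsum (Finset.range t) fun _ _ => sq_nonneg _
  gcongr

end Confinement

/-! ### Vectors from their inner products with a basis. -/

section GramCoordinates

/-- Recovers a vector from its inner products with a basis, through the Gram matrix. -/
theorem sum_inv_gram_mulVec_smul {V : Type*} [NormedAddCommGroup V] [InnerProductSpace ℝ V]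
    {n : ℕ} (v : Module.Basis (Fin n) ℝ V) (u : V) :
    ∑ i, ((Matrix.gram ℝ v)⁻¹.mulVec fun j => inner ℝ u (v j)) i • v i = u := by
  -- The inner products are the Gram matrix applied to the coordinates, and that matrix is
  -- invertible by linear independence.
  have hd : (fun j => inner ℝ u (v j)) = (Matrix.gram ℝ v).mulVec (v.repr u) := by
    ext j
    conv_lhs => rw [← v.sum_repr u, sum_inner]
    simp only [Matrix.mulVec, dotProduct, Matrix.gram_apply]
    refine Finset.sum_congr rfl fun i _ => ?_
    rw [real_inner_smul_left, real_inner_comm, mul_comm]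
  have hdet : IsUnit (Matrix.gram ℝ v).det :=
    (Matrix.det_gram_ne_zero_iff_linearIndependent.2 v.linearIndependent).isUnit
  rw [hd, Matrix.mulVec_mulVec, Matrix.nonsing_inv_mul _ hdet, Matrix.one_mulVec, v.sum_repr]

end GramCoordinates

/-! ### The gradient in a local frame of the tangent bundle. -/

section Frame

variable {m : ℕ} {M : Type*} [TopologicalSpace M]
  [ChartedSpace (EuclideanSpace ℝ (Fin m)) M] [IsManifold (𝓡 m) ∞ M]

/-- The vector of `T_z M` with coordinates `a` in the trivialization of the tangent bundle
at `y`. -/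
noncomputable def chartVec (y z : M) : EuclideanSpace ℝ (Fin m) →L[ℝ] TangentSpace (𝓡 m) z :=
  (trivializationAt (EuclideanSpace ℝ (Fin m)) (TangentSpace (𝓡 m)) y).symmL ℝ z

theorem continuousOn_chartVec (y : M) :
    ContinuousOn (fun p : M × EuclideanSpace ℝ (Fin m) =>
      (⟨p.1, chartVec y p.1 p.2⟩ : TangentBundle (𝓡 m) M))
      ((chartAt (EuclideanSpace ℝ (Fin m)) y).source ×ˢ Set.univ) := by
  have h := (trivializationAt (EuclideanSpace ℝ (Fin m)) (TangentSpace (𝓡 m)) y).continuousOn_symm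
  rw [TangentBundle.trivializationAt_baseSet] at h
  refine h.congr fun p hp => ?_
  have hp' : p.1 ∈ (trivializationAt (EuclideanSpace ℝ (Fin m))
      (TangentSpace (𝓡 m)) y).baseSet := by
    rw [TangentBundle.trivializationAt_baseSet]; exact hp.1
  simp only [chartVec, Trivialization.symmL_apply _ hp']

/-- The basis of `T_z M` induced by the trivialization of the tangent bundle at `y`. -/
noncomputable def chartBasis (y z : M) (hz : z ∈ (chartAt (EuclideanSpace ℝ (Fin m)) y).source) :
    Module.Basis (Fin m) ℝ (TangentSpace (𝓡 m) z) :=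
  (EuclideanSpace.basisFun (Fin m) ℝ).toBasis.map
    ((trivializationAt (EuclideanSpace ℝ (Fin m)) (TangentSpace (𝓡 m)) y).continuousLinearEquivAt
      ℝ z (by rw [TangentBundle.trivializationAt_baseSet]; exact hz)).symm.toLinearEquiv

theorem chartBasis_apply (y z : M) (hz : z ∈ (chartAt (EuclideanSpace ℝ (Fin m)) y).source)
    (i : Fin m) :
    chartBasis y z hz i = chartVec y z (EuclideanSpace.basisFun (Fin m) ℝ i) := by
  have hz' : z ∈ (trivializationAt (EuclideanSpace ℝ (Fin m))
      (TangentSpace (𝓡 m)) y).baseSet := by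
    rw [TangentBundle.trivializationAt_baseSet]; exact hz
  have := congrFun (Trivialization.symm_continuousLinearEquivAt_eq (R := ℝ)
    (trivializationAt (EuclideanSpace ℝ (Fin m)) (TangentSpace (𝓡 m)) y) hz')
    (EuclideanSpace.basisFun (Fin m) ℝ i)
  rw [chartBasis, Module.Basis.map_apply, OrthonormalBasis.coe_toBasis]
  exact this

variable [RiemannianBundle (fun x : M => TangentSpace (𝓡 m) x)]

/-- The Gram matrix of the metric in the trivialization at `y`. -/
noncomputable def chartGram (y z : M) : Matrix (Fin m) (Fin m) ℝ :=
  Matrix.gram ℝ fun i => chartVec y z (EuclideanSpace.basisFun (Fin m) ℝ i)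

/-- The partial derivatives of `h` in the trivialization at `y`. -/
noncomputable def chartPartial (h : M → ℝ) (y z : M) (i : Fin m) : ℝ :=
  differential h z (chartVec y z (EuclideanSpace.basisFun (Fin m) ℝ i))

/-- The coordinates of the gradient of `h` in the trivialization at `y`. -/
noncomputable def chartGrad (h : M → ℝ) (y z : M) : EuclideanSpace ℝ (Fin m) :=
  WithLp.toLp 2 ((chartGram y z)⁻¹.mulVec (chartPartial h y z))

/-- This is the local formula `∇h = G⁻¹ ∂h`. It reduces regularity of a vector in a varying fibre to
that of the scalar entries of `G⁻¹` and `∂h`. -/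
theorem chartVec_chartGrad (h : M → ℝ) {y z : M}
    (hz : z ∈ (chartAt (EuclideanSpace ℝ (Fin m)) y).source) :
    chartVec y z (chartGrad h y z) = rgrad (m := m) h z := by
  have key := sum_inv_gram_mulVec_smul (chartBasis y z hz) (rgrad (m := m) h z)
  have hb : (chartBasis y z hz : Fin m → TangentSpace (𝓡 m) z) = fun i =>
      chartVec y z (EuclideanSpace.basisFun (Fin m) ℝ i) :=
    funext fun i => chartBasis_apply y z hz i
  rw [hb] at key
  have e : chartGrad h y z = ∑ i, ((chartGram (m := m) y z)⁻¹.mulVec (chartPartial h y z)) i •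
      EuclideanSpace.basisFun (Fin m) ℝ i := by
    conv_lhs => rw [← (EuclideanSpace.basisFun (Fin m) ℝ).sum_repr (chartGrad h y z)]
    simp [chartGrad]
  rw [e, map_sum]
  simp only [map_smul]
  refine Eq.trans ?_ key
  refine Finset.sum_congr rfl fun i _ => ?_
  congr 3
  funext j
  exact (inner_rgrad h z _).symm

theorem norm_rgrad_sq_eq (h : M → ℝ) {y z : M}
    (hz : z ∈ (chartAt (EuclideanSpace ℝ (Fin m)) y).source) :
    ‖rgrad (m := m) h z‖ ^ 2
      = ∑ i, ((chartGram (m := m) y z)⁻¹.mulVec (chartPartial (m := m) h y z)) i * chartPartial (m := m) h y z i := by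
  rw [← real_inner_self_eq_norm_sq, inner_rgrad]
  conv_lhs => rw [← chartVec_chartGrad h hz]
  rw [← (EuclideanSpace.basisFun (Fin m) ℝ).sum_repr (chartGrad h y z), map_sum, map_sum]
  refine Finset.sum_congr rfl fun i _ => ?_
  rw [map_smul, map_smul]
  simp [chartGrad, chartPartial]

theorem continuousOn_chartGram [IsContinuousRiemannianBundle (EuclideanSpace ℝ (Fin m))
    (fun x : M => TangentSpace (𝓡 m) x)] (y : M) :
    ContinuousOn (chartGram (m := m) y) (chartAt (EuclideanSpace ℝ (Fin m)) y).source := by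
  refine continuousOn_pi.2 fun i => continuousOn_pi.2 fun j => ?_
  have hs : ∀ i : Fin m, ContinuousOn (fun z => (⟨z, chartVec y z
      (EuclideanSpace.basisFun (Fin m) ℝ i)⟩ : TangentBundle (𝓡 m) M))
      (chartAt (EuclideanSpace ℝ (Fin m)) y).source := fun i =>
    (continuousOn_chartVec y).comp (f := fun z : M => (z, EuclideanSpace.basisFun (Fin m) ℝ i))
      (by fun_prop) fun z hz => ⟨hz, trivial⟩
  exact (hs i).inner_bundle (hs j)

theorem continuousOn_chartGram_inv [IsContinuousRiemannianBundle (EuclideanSpace ℝ (Fin m))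
    (fun x : M => TangentSpace (𝓡 m) x)] (y : M) :
    ContinuousOn (fun z => (chartGram (m := m) y z)⁻¹)
      (chartAt (EuclideanSpace ℝ (Fin m)) y).source := by
  intro z hz
  have hdet : (chartGram (m := m) y z).det ≠ 0 := by
    have := Matrix.det_gram_ne_zero_iff_linearIndependent.2 (chartBasis y z hz).linearIndependent
    rwa [show (chartBasis y z hz : Fin m → TangentSpace (𝓡 m) z) = fun i =>
      chartVec y z (EuclideanSpace.basisFun (Fin m) ℝ i) from
        funext fun i => chartBasis_apply y z hz i] at this
  refine ContinuousAt.comp_continuousWithinAt (continuousAt_matrix_inv _ ?_)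
    (continuousOn_chartGram y z hz)
  exact NormedRing.inverse_continuousAt (Units.mk0 _ hdet)

/-- The norm of the gradient is continuous where the partial derivatives are. -/
theorem continuousAt_norm_rgrad [IsContinuousRiemannianBundle (EuclideanSpace ℝ (Fin m))
    (fun x : M => TangentSpace (𝓡 m) x)] {h : M → ℝ} {y : M}
    (hh : ContinuousAt (chartPartial (m := m) h y) y) :
    ContinuousAt (fun z => ‖rgrad (m := m) h z‖) y := by
  have hsrc := (chartAt (EuclideanSpace ℝ (Fin m)) y).open_source.mem_nhds
    (mem_chart_source _ y)
  have hG := (continuousOn_chartGram_inv (m := m) y).continuousAt hsrc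
  have h2 : ContinuousAt (fun z => √(∑ i, ((chartGram (m := m) y z)⁻¹.mulVec (chartPartial h y z)) i *
      chartPartial h y z i)) y := by
    have hentry : ∀ i j, ContinuousAt (fun z => (chartGram (m := m) y z)⁻¹ i j) y := fun i j =>
      continuousAt_pi.1 (continuousAt_pi.1 hG i) j
    have hpart : ∀ i, ContinuousAt (fun z => chartPartial (m := m) h y z i) y :=
      continuousAt_pi.1 hh
    simp only [Matrix.mulVec, dotProduct]
    fun_prop
  refine h2.congr ?_
  filter_upwards [hsrc] with z hz
  rw [← norm_rgrad_sq_eq h hz, Real.sqrt_sq (norm_nonneg _)]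

end Frame

/-! ### Joint measurability of the gradient step. -/

section Measurability

variable {m : ℕ} {M : Type*} [TopologicalSpace M]
  [ChartedSpace (EuclideanSpace ℝ (Fin m)) M] {Ω : Type*}

theorem measurable_uncurry_of_differentiableInM [MeasurableSpace M] [BorelSpace M]
    [SecondCountableTopology M] [TopologicalSpace.MetrizableSpace M] [MeasurableSpace Ω]
    {h : M → Ω → ℝ} (hd : DifferentiableInM (m := m) h)
    (hm : ∀ x, Measurable (h x)) : Measurable fun p : M × Ω => h p.1 p.2 :=
  measurable_uncurry_of_continuous_of_measurable (u := fun x ξ => h x ξ)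
    (fun ξ => (hd ξ).continuous) hm

variable [IsManifold (𝓡 m) ∞ M] [RiemannianBundle (fun x : M => TangentSpace (𝓡 m) x)]
  {R : TangentBundle (𝓡 m) M → M}

theorem differentiableAt_pullback_zero (hR : IsRetraction R) {g : M → ℝ} {x : M}
    (hg : MDifferentiableAt (𝓡 m) 𝓘(ℝ, ℝ) g x) :
    DifferentiableAt ℝ (fun v : TangentSpace (𝓡 m) x => g (R ⟨x, v⟩)) 0 := by
  have hg' : MDifferentiableAt 𝓘(ℝ, TangentSpace (𝓡 m) x) 𝓘(ℝ, ℝ)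
      (fun v : TangentSpace (𝓡 m) x => g (R ⟨x, v⟩)) 0 :=
    MDifferentiableAt.comp (I' := 𝓡 m) (g := g)
      (f := fun v : TangentSpace (𝓡 m) x => R ⟨x, v⟩) (0 : TangentSpace (𝓡 m) x)
      (by rw [hR.map_zero x]; exact hg)
      ((contMDiff_comp_fiberInclusion hR.contMDiff x).mdifferentiable one_ne_zero _)
  exact hg'.differentiableAt

/-- Difference quotients along the retraction compute the differential. -/
theorem tendsto_difference_quotient (hR : IsRetraction R) {g : M → ℝ} {x : M}
    (hg : MDifferentiableAt (𝓡 m) 𝓘(ℝ, ℝ) g x) (v : TangentSpace (𝓡 m) x) :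
    Tendsto (fun n : ℕ => ((n : ℝ) + 1) * (g (R ⟨x, ((n : ℝ) + 1)⁻¹ • v⟩) - g x)) atTop
      (𝓝 (differential g x v)) := by
  have h1 := (differentiableAt_pullback_zero hR hg).hasFDerivAt.lim_real v
  rw [fderiv_pullback_zero hR hg] at h1
  have h2 := h1.comp (tendsto_atTop_add_const_right atTop (1 : ℝ) tendsto_natCast_atTop_atTop)
  refine h2.congr fun n => ?_
  simp only [Function.comp, zero_add, hR.map_zero, smul_eq_mul]

variable [MeasurableSpace Ω] {h : M → Ω → ℝ}
  [IsContinuousRiemannianBundle (EuclideanSpace ℝ (Fin m)) (fun x : M => TangentSpace (𝓡 m) x)]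
  [MeasurableSpace M] [BorelSpace M] [SecondCountableTopology M]
  [TopologicalSpace.MetrizableSpace M]

/-- The partial derivatives are pointwise limits of difference quotients along `R`, each jointly
measurable since `h` is a Carathéodory function; the inverse Gram entries are continuous. -/
theorem measurable_chartGrad (hR : IsRetraction R) (hd : DifferentiableInM (m := m) h)
    (hm : ∀ x, Measurable (h x)) (y : M) :
    Measurable fun p : (chartAt (EuclideanSpace ℝ (Fin m)) y).source × Ω =>
      chartGrad (m := m) (fun x => h x p.2) y p.1 := by
  have hG : ∀ i j, Measurable fun z : (chartAt (EuclideanSpace ℝ (Fin m)) y).source =>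
      (chartGram (m := m) y z)⁻¹ i j := fun i j => by
    have := (continuousOn_iff_continuous_domRestrict.1 (continuousOn_chartGram_inv (m := m) y))
    exact ((continuous_apply j).comp ((continuous_apply i).comp this)).measurable
  have hP : ∀ i, Measurable fun p : (chartAt (EuclideanSpace ℝ (Fin m)) y).source × Ω =>
      chartPartial (m := m) (fun x => h x p.2) y p.1 i := fun i => by
    refine measurable_of_tendsto_metrizable (f := fun (n : ℕ)
      (p : (chartAt (EuclideanSpace ℝ (Fin m)) y).source × Ω) =>
        ((n : ℝ) + 1) * (h (R ⟨p.1, ((n : ℝ) + 1)⁻¹ • chartVec y p.1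
          (EuclideanSpace.basisFun (Fin m) ℝ i)⟩) p.2 - h p.1 p.2)) (fun n => ?_)
      (tendsto_pi_nhds.2 fun p => tendsto_difference_quotient hR (hd p.2 _) _)
    have hu := measurable_uncurry_of_differentiableInM hd hm
    have hq : Continuous fun z : (chartAt (EuclideanSpace ℝ (Fin m)) y).source =>
        R ⟨z, ((n : ℝ) + 1)⁻¹ • chartVec y z (EuclideanSpace.basisFun (Fin m) ℝ i)⟩ := by
      refine hR.contMDiff.continuous.comp ?_
      simp only [← map_smul]
      exact (continuousOn_chartVec y).comp_continuous
        (f := fun z : (chartAt (EuclideanSpace ℝ (Fin m)) y).source =>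
          ((z : M), ((n : ℝ) + 1)⁻¹ • EuclideanSpace.basisFun (Fin m) ℝ i))
        (by fun_prop) fun z => ⟨z.2, trivial⟩
    refine measurable_const.mul (Measurable.sub ?_ ?_)
    · exact hu.comp ((hq.measurable.comp measurable_fst).prodMk measurable_snd)
    · exact hu.comp ((measurable_subtype_coe.comp measurable_fst).prodMk measurable_snd)
  refine (PiLp.continuous_toLp 2 _).measurable.comp (measurable_pi_lambda _ fun i => ?_)
  simp only [Matrix.mulVec, dotProduct]
  exact Finset.measurable_sum _ fun j _ => ((hG i j).comp measurable_fst).mul (hP j)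

/-- Retracting the gradient of a random function is jointly measurable. -/
theorem measurable_retraction_rgrad (hR : IsRetraction R) (hd : DifferentiableInM (m := m) h)
    (hm : ∀ x, Measurable (h x)) :
    Measurable fun p : M × Ω => R ⟨p.1, rgrad (m := m) (fun y => h y p.2) p.1⟩ := by
  have hloc : ∀ y : M, Measurable fun p : (chartAt (EuclideanSpace ℝ (Fin m)) y).source × Ω =>
      R ⟨p.1, rgrad (m := m) (fun x => h x p.2) p.1⟩ := fun y => by
    have hc : Continuous fun q : (chartAt (EuclideanSpace ℝ (Fin m)) y).source ×
        EuclideanSpace ℝ (Fin m) => R ⟨q.1, chartVec y q.1 q.2⟩ :=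
      hR.contMDiff.continuous.comp ((continuousOn_chartVec y).comp_continuous
        (f := fun q : (chartAt (EuclideanSpace ℝ (Fin m)) y).source ×
          EuclideanSpace ℝ (Fin m) => ((q.1 : M), q.2)) (by fun_prop) fun q => ⟨q.1.2, trivial⟩)
    have := hc.measurable.comp (measurable_fst.prodMk (measurable_chartGrad hR hd hm y))
    refine Eq.mp (congrArg Measurable (funext fun p => ?_)) this
    simp only [Function.comp, chartVec_chartGrad (m := m) (fun x => h x p.2) p.1.2]
  -- Countably many chart domains cover `M`. Their inclusions are measurable embeddings, so the
  -- preimage of `V` is a countable union of measurable images.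
  obtain ⟨s, hs, hcov⟩ := TopologicalSpace.countable_cover_nhds (α := M)
    (f := fun y => (chartAt (EuclideanSpace ℝ (Fin m)) y).source)
    fun y => (chartAt (EuclideanSpace ℝ (Fin m)) y).open_source.mem_nhds (mem_chart_source _ y)
  intro V hV
  have e : (fun p : M × Ω => R ⟨p.1, rgrad (m := m) (fun y => h y p.2) p.1⟩) ⁻¹' V
      = ⋃ y ∈ s, (Prod.map Subtype.val id) ''
        ((fun p : (chartAt (EuclideanSpace ℝ (Fin m)) y).source × Ω =>
          R ⟨p.1, rgrad (m := m) (fun x => h x p.2) p.1⟩) ⁻¹' V) := by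
    ext ⟨z, ζ⟩
    have hz : z ∈ ⋃ y ∈ s, (chartAt (EuclideanSpace ℝ (Fin m)) y).source := hcov ▸ trivial
    simp only [Set.mem_iUnion, exists_prop] at hz ⊢
    constructor
    · intro h1
      obtain ⟨y, hy, hzy⟩ := hz
      exact ⟨y, hy, (⟨z, hzy⟩, ζ), h1, rfl⟩
    · rintro ⟨y, hy, ⟨⟨z', hz'⟩, ζ'⟩, h1, h2⟩
      obtain ⟨rfl, rfl⟩ := Prod.ext_iff.1 h2
      exact h1
  rw [e]
  refine MeasurableSet.biUnion hs fun y _ => ?_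
  have hemb := (MeasurableEmbedding.subtype_coe
    (chartAt (EuclideanSpace ℝ (Fin m)) y).open_source.measurableSet).prodMap
    (MeasurableEmbedding.id : MeasurableEmbedding (id : Ω → Ω))
  exact hemb.measurableSet_image.2 (hloc y hV)

end Measurability

/-! ### Differentiation under the integral sign on a vector space. -/

section ParametricIntegral

variable {V : Type*} [NormedAddCommGroup V] [NormedSpace ℝ V] {Ω : Type*} [MeasurableSpace Ω]

/-- In finite dimension `L` is a finite sum of fixed coordinate functionals weighted by the
measurable scalars `L ξ (e_i)`. -/
theorem stronglyMeasurable_dual_of_apply [FiniteDimensional ℝ V] {L : Ω → V →L[ℝ] ℝ}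
    (h : ∀ v, Measurable fun ξ => L ξ v) : StronglyMeasurable L := by
  have e : L = fun ξ => ∑ i, L ξ (Module.finBasis ℝ V i) •
      LinearMap.toContinuousLinearMap ((Module.finBasis ℝ V).coord i) := by
    ext ξ v
    conv_lhs => rw [← (Module.finBasis ℝ V).sum_repr v, map_sum]
    simp [mul_comm]
  rw [e]
  exact Finset.stronglyMeasurable_fun_sum _ fun i _ =>
    (h _).stronglyMeasurable.smul_const _

theorem measurable_fderiv_apply_of_measurable {g : V → Ω → ℝ} (hm : ∀ v, Measurable (g v))
    {v : V} (hd : ∀ ξ, DifferentiableAt ℝ (fun w => g w ξ) v) (u : V) :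
    Measurable fun ξ => fderiv ℝ (fun w => g w ξ) v u := by
  refine measurable_of_tendsto_metrizable (f := fun (n : ℕ) ξ =>
    (n : ℝ) * (g (v + (n : ℝ)⁻¹ • u) ξ - g v ξ)) (fun n => ?_) (tendsto_pi_nhds.2 fun ξ => ?_)
  · exact measurable_const.mul ((hm _).sub (hm _))
  · exact ((hd ξ).hasFDerivAt.lim_real u).comp tendsto_natCast_atTop_atTop

/-- Differentiation under the integral sign with a bound on the derivatives on a ball. -/
theorem integral_hasFDerivAt_of_bounded [FiniteDimensional ℝ V] {μ : Measure Ω} [IsProbabilityMeasure μ] {g : V → Ω → ℝ}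
    (hm : ∀ v, Measurable (g v)) (hi : ∀ v, Integrable (g v) μ)
    (hd : ∀ ξ, Differentiable ℝ (fun w => g w ξ)) {r B : ℝ}
    (hB : ∀ v, ‖v‖ < r → ∀ ξ, ‖fderiv ℝ (fun w => g w ξ) v‖ ≤ B) {v : V} (hv : ‖v‖ < r) :
    Integrable (fun ξ => fderiv ℝ (fun w => g w ξ) v) μ ∧
      HasFDerivAt (fun w => ∫ ξ, g w ξ ∂μ) (∫ ξ, fderiv ℝ (fun w => g w ξ) v ∂μ) v := by
  have hsm : StronglyMeasurable fun ξ => fderiv ℝ (fun w => g w ξ) v :=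
    stronglyMeasurable_dual_of_apply fun u =>
      measurable_fderiv_apply_of_measurable hm (fun ξ => hd ξ v) u
  refine ⟨Integrable.of_bound hsm.aestronglyMeasurable B (ae_of_all _ fun ξ => hB v hv ξ), ?_⟩
  refine hasFDerivAt_integral_of_dominated_of_fderiv_le (bound := fun _ => B)
    (F' := fun v ξ => fderiv ℝ (fun w => g w ξ) v)
    (s := Metric.ball 0 r) (Metric.isOpen_ball.mem_nhds (by simpa using hv))
    (Eventually.of_forall fun w => (hm w).aestronglyMeasurable) (hi v) hsm.aestronglyMeasurable
    (ae_of_all _ fun ξ w hw => hB w (by simpa using hw) ξ) (integrable_const _)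
    (ae_of_all _ fun ξ w _ => (hd ξ w).hasFDerivAt)

end ParametricIntegral

/-! ### The first-order remainder of a function with Lipschitz derivative at the origin. -/

section QuadraticBound

/-- A function whose derivative is Lipschitz relative to the origin is quadratically close to its
first-order expansion there. -/
theorem abs_sub_le_of_fderiv_lipschitz_zero {V : Type*} [NormedAddCommGroup V] [NormedSpace ℝ V]
    {g : V → ℝ} (hg : Differentiable ℝ g) {C r : ℝ} (hC : 0 ≤ C)
    (h : ∀ v, ‖v‖ ≤ r → ‖fderiv ℝ g v - fderiv ℝ g 0‖ ≤ C * ‖v‖) {v : V} (hv : ‖v‖ ≤ r) :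
    |g v - g 0 - fderiv ℝ g 0 v| ≤ C * ‖v‖ ^ 2 := by
  -- Mean value inequality for `g - dg(0)` on the ball of radius `‖v‖`, where its derivative has
  -- norm at most `C ‖v‖`.
  have key := (convex_closedBall (0 : V) ‖v‖).norm_image_sub_le_of_norm_hasFDerivWithin_le
    (f := fun w => g w - fderiv ℝ g 0 w) (f' := fun w => fderiv ℝ g w - fderiv ℝ g 0)
    (C := C * ‖v‖) (x := 0) (y := v)
    (fun w _ => ((hg w).hasFDerivAt.sub (fderiv ℝ g 0).hasFDerivAt).hasFDerivWithinAt)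
    (fun w hw => by
      have hw' : ‖w‖ ≤ ‖v‖ := by simpa using hw
      exact (h w (hw'.trans hv)).trans (by gcongr)) (by simp) (by simp)
  rw [map_zero, sub_zero, sub_zero, Real.norm_eq_abs] at key
  calc |g v - g 0 - fderiv ℝ g 0 v| = |g v - fderiv ℝ g 0 v - g 0| := by ring_nf
    _ ≤ C * ‖v‖ * ‖v‖ := key
    _ = C * ‖v‖ ^ 2 := by ring

end QuadraticBound

/-! ### The retraction as a local parametrization of the manifold. -/

section LocalInverse

variable {m : ℕ} {M : Type*} [TopologicalSpace M]
  [ChartedSpace (EuclideanSpace ℝ (Fin m)) M] [IsManifold (𝓡 m) ∞ M]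
  [RiemannianBundle (fun x : M => TangentSpace (𝓡 m) x)]
  {R : TangentBundle (𝓡 m) M → M}

/-- The differential of the chart at `x`, as an isomorphism `T_x M ≃ ℝ^m`. -/
theorem exists_equiv_hasFDerivAt_chart_retraction (hR : IsRetraction R) (x : M) :
    ContDiffAt ℝ 1 (fun v : TangentSpace (𝓡 m) x => extChartAt (𝓡 m) x (R ⟨x, v⟩)) 0 ∧
    ∃ L : TangentSpace (𝓡 m) x ≃L[ℝ] EuclideanSpace ℝ (Fin m),
      HasFDerivAt (fun v : TangentSpace (𝓡 m) x => extChartAt (𝓡 m) x (R ⟨x, v⟩))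
        (L : TangentSpace (𝓡 m) x →L[ℝ] EuclideanSpace ℝ (Fin m)) 0 := by
  have hc : ContMDiffAt 𝓘(ℝ, TangentSpace (𝓡 m) x) 𝓘(ℝ, EuclideanSpace ℝ (Fin m)) 1
      (fun v : TangentSpace (𝓡 m) x => extChartAt (𝓡 m) x (R ⟨x, v⟩)) 0 :=
    ContMDiffAt.comp (I' := 𝓡 m) (g := extChartAt (𝓡 m) x)
      (f := fun v : TangentSpace (𝓡 m) x => R ⟨x, v⟩) (0 : TangentSpace (𝓡 m) x)
      (by rw [hR.map_zero x]; exact contMDiffAt_extChartAt)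
      (contMDiff_comp_fiberInclusion hR.contMDiff x _)
  refine ⟨hc.contDiffAt, ?_⟩
  let e := trivializationAt (EuclideanSpace ℝ (Fin m)) (TangentSpace (𝓡 m)) x
  have hx : x ∈ e.baseSet := FiberBundle.mem_baseSet_trivializationAt' x
  refine ⟨e.continuousLinearEquivAt ℝ x hx, ?_⟩
  have h1 : HasMFDerivAt 𝓘(ℝ, TangentSpace (𝓡 m) x) (𝓡 m)
      (fun v : TangentSpace (𝓡 m) x => R ⟨x, v⟩) 0
      (ContinuousLinearMap.id ℝ (TangentSpace (𝓡 m) x)) := by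
    have := ((contMDiff_comp_fiberInclusion hR.contMDiff x).mdifferentiable one_ne_zero
      (0 : TangentSpace (𝓡 m) x)).hasMFDerivAt
    rw [hR.mfderiv_zero x] at this
    exact this
  have h2 : ∀ y : M, y = x → HasMFDerivAt (𝓡 m) 𝓘(ℝ, EuclideanSpace ℝ (Fin m))
      (extChartAt (𝓡 m) x) y (mfderiv (𝓡 m) 𝓘(ℝ, EuclideanSpace ℝ (Fin m))
      (extChartAt (𝓡 m) x) x) := by
    rintro _ rfl
    exact (mdifferentiableAt_extChartAt (mem_chart_source _ _)).hasMFDerivAt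
  have h3 := HasMFDerivAt.comp (0 : TangentSpace (𝓡 m) x) (h2 _ (hR.map_zero x)) h1
  have h4 := h3.hasFDerivAt
  -- The differential of the chart at its centre is the fibre map of the trivialization, hence
  -- invertible; precomposing with `dR_x(0) = id` does not change it.
  rw [← TangentBundle.continuousLinearMapAt_trivializationAt (mem_chart_source _ x)] at h4
  rw [Trivialization.coe_continuousLinearEquivAt_eq']
  exact h4

/-- Inverse function theorem for `R_x` read in the chart. It allows regularity at `x` of a function
on `M` to be tested on its pullback to `T_x M`. -/
theorem exists_local_inverse (hR : IsRetraction R) (x : M) :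
    ∃ Φ : EuclideanSpace ℝ (Fin m) → TangentSpace (𝓡 m) x,
      ContDiffAt ℝ 1 Φ (extChartAt (𝓡 m) x x) ∧ Φ (extChartAt (𝓡 m) x x) = 0 ∧
      ∀ᶠ p in 𝓝 (extChartAt (𝓡 m) x x), R ⟨x, Φ p⟩ = (extChartAt (𝓡 m) x).symm p := by
  obtain ⟨hc, L, hL⟩ := exists_equiv_hasFDerivAt_chart_retraction hR x
  have e0 : extChartAt (𝓡 m) x (R ⟨x, 0⟩) = extChartAt (𝓡 m) x x := by rw [hR.map_zero]
  have h1 := hc.to_localInverse hL one_ne_zero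
  have h2 := hc.localInverse_apply_image hL one_ne_zero
  have h3 := (hc.hasStrictFDerivAt' hL one_ne_zero).eventually_right_inverse
  change ∀ᶠ p in 𝓝 (extChartAt (𝓡 m) x (R ⟨x, 0⟩)),
    extChartAt (𝓡 m) x (R ⟨x, hc.localInverse hL one_ne_zero p⟩) = p at h3
  change ContDiffAt ℝ 1 _ (extChartAt (𝓡 m) x (R ⟨x, 0⟩)) at h1
  change hc.localInverse hL one_ne_zero (extChartAt (𝓡 m) x (R ⟨x, 0⟩)) = 0 at h2
  rw [e0] at h1 h2 h3
  refine ⟨hc.localInverse hL one_ne_zero, h1, h2, ?_⟩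
  have h4 : ContinuousAt (fun p => R ⟨x, hc.localInverse hL one_ne_zero p⟩)
      (extChartAt (𝓡 m) x x) :=
    ContinuousAt.comp (g := fun v : TangentSpace (𝓡 m) x => R ⟨x, v⟩)
      (contMDiff_comp_fiberInclusion hR.contMDiff x).continuous.continuousAt h1.continuousAt
  have h5 : (extChartAt (𝓡 m) x).source ∈
      𝓝 (R ⟨x, hc.localInverse hL one_ne_zero (extChartAt (𝓡 m) x x)⟩) := by
    rw [h2, hR.map_zero]
    exact extChartAt_source_mem_nhds x
  filter_upwards [h3, h4 h5] with p hp hs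
  exact ((extChartAt (𝓡 m) x).left_inv hs).symm.trans (congrArg _ hp)

variable {F : M → ℝ}

theorem mdifferentiableAt_of_pullback (hR : IsRetraction R) {x : M}
    (hF : DifferentiableAt ℝ (fun v : TangentSpace (𝓡 m) x => F (R ⟨x, v⟩)) 0) :
    MDifferentiableAt (𝓡 m) 𝓘(ℝ, ℝ) F x := by
  obtain ⟨Φ, hΦ, hΦ0, hΦR⟩ := exists_local_inverse hR x
  have h1 : DifferentiableAt ℝ (fun p => F (R ⟨x, Φ p⟩)) (extChartAt (𝓡 m) x x) :=
    DifferentiableAt.comp (g := fun v : TangentSpace (𝓡 m) x => F (R ⟨x, v⟩))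
      (extChartAt (𝓡 m) x x) (by rw [hΦ0]; exact hF) (hΦ.differentiableAt one_ne_zero)
  have h2 : MDifferentiableAt (𝓡 m) 𝓘(ℝ, ℝ)
      ((fun p => F (R ⟨x, Φ p⟩)) ∘ extChartAt (𝓡 m) x) x :=
    h1.mdifferentiableAt.comp x (mdifferentiableAt_extChartAt (mem_chart_source _ _))
  refine h2.congr_of_eventuallyEq ?_
  filter_upwards [(continuousAt_extChartAt (I := 𝓡 m) x).eventually hΦR,
    extChartAt_source_mem_nhds (I := 𝓡 m) x] with z hz hs
  simp only [Function.comp, hz, (extChartAt (𝓡 m) x).left_inv hs]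

theorem chartPartial_eq_fderiv {x z : M} (hF : MDifferentiableAt (𝓡 m) 𝓘(ℝ, ℝ) F z)
    (hz : z ∈ (chartAt (EuclideanSpace ℝ (Fin m)) x).source) (i : Fin m) :
    chartPartial F x z i = fderiv ℝ (fun p => F ((extChartAt (𝓡 m) x).symm p))
      (extChartAt (𝓡 m) x z) (EuclideanSpace.basisFun (Fin m) ℝ i) := by
  have hzs : z ∈ (extChartAt (𝓡 m) x).source := by rwa [extChartAt_source]
  have h1 : MDifferentiableAt 𝓘(ℝ, EuclideanSpace ℝ (Fin m)) (𝓡 m) (extChartAt (𝓡 m) x).symm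
      (extChartAt (𝓡 m) x z) := by
    have := mdifferentiableWithinAt_extChartAt_symm ((extChartAt (𝓡 m) x).map_source hzs)
    rwa [modelWithCornersSelf_coe, Set.range_id, mdifferentiableWithinAt_univ] at this
  have h2 : ∀ y : M, y = z → HasMFDerivAt (𝓡 m) 𝓘(ℝ, ℝ) F y (mfderiv (𝓡 m) 𝓘(ℝ, ℝ) F z) := by
    rintro _ rfl
    exact hF.hasMFDerivAt
  have h3 := HasMFDerivAt.comp (extChartAt (𝓡 m) x z) (h2 _ ((extChartAt (𝓡 m) x).left_inv hzs))
    h1.hasMFDerivAt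
  have h4 : chartVec (m := m) x z = mfderiv 𝓘(ℝ, EuclideanSpace ℝ (Fin m)) (𝓡 m)
      (extChartAt (𝓡 m) x).symm (extChartAt (𝓡 m) x z) := by
    rw [chartVec, TangentBundle.symmL_trivializationAt hz, modelWithCornersSelf_coe, Set.range_id,
      mfderivWithin_univ]
  rw [← h4] at h3
  have h5 : HasFDerivAt (fun p => F ((extChartAt (𝓡 m) x).symm p))
    ((differential F z).comp (chartVec x z)) (extChartAt (𝓡 m) x z) := h3.hasFDerivAt
  rw [h5.fderiv]
  rfl

/-- Near `x` one has `F ∘ chart⁻¹ = (F ∘ R_x) ∘ Φ`, so all nearby partial derivatives of `F` are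
expressed through the pullback to the one fibre `T_x M`. Continuity of its derivative at `0` alone
is what the Lipschitz hypothesis supplies. -/
theorem continuousAt_chartPartial (hR : IsRetraction R)
    (hF : MDifferentiable (𝓡 m) 𝓘(ℝ, ℝ) F) {x : M}
    (hc : ContinuousAt (fderiv ℝ (fun v : TangentSpace (𝓡 m) x => F (R ⟨x, v⟩))) 0) :
    ContinuousAt (chartPartial (m := m) F x) x := by
  obtain ⟨Φ, hΦ, hΦ0, hΦR⟩ := exists_local_inverse hR x
  refine continuousAt_pi.2 fun i => ?_
  have h1 : ∀ᶠ p in 𝓝 (extChartAt (𝓡 m) x x),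
      fderiv ℝ (fun p => F ((extChartAt (𝓡 m) x).symm p)) p
        = (fderiv ℝ (fun v : TangentSpace (𝓡 m) x => F (R ⟨x, v⟩)) (Φ p)).comp
          (fderiv ℝ Φ p) := by
    -- To differentiate at `p`, the identity is needed on a whole neighbourhood of `p`.
    filter_upwards [hΦR.eventually_nhds, hΦ.eventually (by simp)] with p hp hd
    have e : (fun p => F ((extChartAt (𝓡 m) x).symm p)) =ᶠ[𝓝 p]
        (fun v : TangentSpace (𝓡 m) x => F (R ⟨x, v⟩)) ∘ Φ := by
      filter_upwards [hp] with q hq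
      simp only [Function.comp, hq]
    rw [e.fderiv_eq]
    exact fderiv_comp p (differentiable_pullback hR hF x _) (hd.differentiableAt one_ne_zero)
  have h2 : ContinuousAt (fun p => (fderiv ℝ (fun v : TangentSpace (𝓡 m) x => F (R ⟨x, v⟩)) (Φ p))
      (fderiv ℝ Φ p (EuclideanSpace.basisFun (Fin m) ℝ i))) (extChartAt (𝓡 m) x x) := by
    have hc' : ContinuousAt (fun p => fderiv ℝ (fun v : TangentSpace (𝓡 m) x => F (R ⟨x, v⟩)) (Φ p))
      (extChartAt (𝓡 m) x x) :=
      ContinuousAt.comp (g := fderiv ℝ (fun v : TangentSpace (𝓡 m) x => F (R ⟨x, v⟩)))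
        (by rw [hΦ0]; exact hc) hΦ.continuousAt
    have hd : ContinuousAt (fderiv ℝ Φ) (extChartAt (𝓡 m) x x) :=
      (hΦ.fderiv_right (m := 0) (by simp)).continuousAt
    exact hc'.clm_apply (hd.clm_apply continuousAt_const)
  have h3 := ContinuousAt.comp h2 (continuousAt_extChartAt (I := 𝓡 m) x)
  refine h3.congr ?_
  filter_upwards [(continuousAt_extChartAt (I := 𝓡 m) x).eventually h1,
    chart_source_mem_nhds (EuclideanSpace ℝ (Fin m)) x] with z hz hs
  rw [chartPartial_eq_fderiv (hF z) hs, hz]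
  rfl

end LocalInverse

/-! ### Differentiability and expansion of the mean function. -/

section MeanFunction

theorem norm_gradient_sub_gradient {V : Type*} [NormedAddCommGroup V] [InnerProductSpace ℝ V]
    [CompleteSpace V] (g : V → ℝ) (v w : V) :
    ‖gradient g v - gradient g w‖ = ‖fderiv ℝ g v - fderiv ℝ g w‖ := by
  rw [gradient, gradient, ← map_sub, LinearIsometryEquiv.norm_map]

/-- Differentiation under the integral sign when the derivatives are bounded on balls. -/
theorem differentiable_integral_of_bounded {V : Type*} [NormedAddCommGroup V] [NormedSpace ℝ V]
    [FiniteDimensional ℝ V] {Ω : Type*} [MeasurableSpace Ω] {μ : Measure Ω}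
    [IsProbabilityMeasure μ] {g : V → Ω → ℝ}
    (hm : ∀ v, Measurable (g v)) (hi : ∀ v, Integrable (g v) μ)
    (hd : ∀ ξ, Differentiable ℝ (fun w => g w ξ))
    (hB : ∀ r : ℝ, 0 < r → ∃ B, ∀ v, ‖v‖ < r → ∀ ξ, ‖fderiv ℝ (fun w => g w ξ) v‖ ≤ B) :
    Differentiable ℝ (fun w => ∫ ξ, g w ξ ∂μ) ∧
    (∀ v u, Integrable (fun ξ => fderiv ℝ (fun w => g w ξ) v u) μ ∧
      fderiv ℝ (fun w => ∫ ξ, g w ξ ∂μ) v u = ∫ ξ, fderiv ℝ (fun w => g w ξ) v u ∂μ) ∧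
    ∀ v w (C : ℝ), (∀ ξ, ‖fderiv ℝ (fun w => g w ξ) v - fderiv ℝ (fun w => g w ξ) w‖ ≤ C) →
      ‖fderiv ℝ (fun w => ∫ ξ, g w ξ ∂μ) v - fderiv ℝ (fun w => ∫ ξ, g w ξ ∂μ) w‖ ≤ C := by
  have key : ∀ v, Integrable (fun ξ => fderiv ℝ (fun w => g w ξ) v) μ ∧
      HasFDerivAt (fun w => ∫ ξ, g w ξ ∂μ) (∫ ξ, fderiv ℝ (fun w => g w ξ) v ∂μ) v := fun v => by
    obtain ⟨B, hB⟩ := hB (‖v‖ + 1) (by positivity)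
    exact integral_hasFDerivAt_of_bounded hm hi hd hB (by linarith)
  refine ⟨fun v => (key v).2.differentiableAt, fun v u => ⟨?_, ?_⟩, fun v w C h => ?_⟩
  · exact ContinuousLinearMap.integrable_comp (ContinuousLinearMap.apply ℝ ℝ u) (key v).1
  · rw [(key v).2.fderiv, ContinuousLinearMap.integral_apply (key v).1]
  · rw [(key v).2.fderiv, (key w).2.fderiv, ← integral_sub (key v).1 (key w).1]
    simpa using norm_integral_le_of_norm_le_const (μ := μ) (ae_of_all _ h)

theorem continuousAt_fderiv_zero_of_norm_sub_le {V : Type*} [NormedAddCommGroup V]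
    [NormedSpace ℝ V] {g : V → ℝ} {C : ℝ}
    (h : ∀ v, ‖v‖ ≤ 1 → ‖fderiv ℝ g v - fderiv ℝ g 0‖ ≤ C * ‖v‖) :
    ContinuousAt (fderiv ℝ g) 0 := by
  rw [ContinuousAt, tendsto_iff_norm_sub_tendsto_zero]
  refine squeeze_zero' (Eventually.of_forall fun _ => norm_nonneg _)
    (g := fun v => C * ‖v‖) ?_ ?_
  · filter_upwards [Metric.closedBall_mem_nhds (0 : V) one_pos] with v hv
    exact h v (by simpa using hv)
  · exact (by fun_prop : Continuous fun v : V => C * ‖v‖).tendsto' 0 0 (by simp)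

variable {m : ℕ} {M : Type*} [TopologicalSpace M]
  [ChartedSpace (EuclideanSpace ℝ (Fin m)) M]
  {Ω : Type*} {f : M → Ω → ℝ}

theorem integrable_of_locallyBounded [MeasurableSpace Ω] {μ : Measure Ω} [IsFiniteMeasure μ]
    (hm : ∀ x, Measurable (f x)) (hb : LocallyBounded f)
    (y : M) : Integrable (f y) μ := by
  obtain ⟨C, -, hC⟩ := hb {y} isCompact_singleton
  exact Integrable.of_bound (hm y).aestronglyMeasurable C (ae_of_all _ fun ξ => hC y rfl ξ)

variable [RiemannianBundle (fun x : M => TangentSpace (𝓡 m) x)]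

theorem norm_fderiv_pullback_sub (f : M → Ω → ℝ) (R : TangentBundle (𝓡 m) M → M)
    (hlip : LocallyRLipschitzGradient R f) {K : Set M} (hK : IsCompact K) {r : ℝ} (hr : 0 < r) :
    ∃ C : ℝ, 0 < C ∧ ∀ x ∈ K, ∀ v : TangentSpace (𝓡 m) x, ‖v‖ ≤ r → ∀ ξ : Ω,
      ‖fderiv ℝ (fun w : TangentSpace (𝓡 m) x => f (R ⟨x, w⟩) ξ) v
        - fderiv ℝ (fun w : TangentSpace (𝓡 m) x => f (R ⟨x, w⟩) ξ) 0‖ ≤ C * ‖v‖ := by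
  obtain ⟨C, hC, h⟩ := hlip K hK r hr
  refine ⟨C, hC, fun x hx v hv ξ => ?_⟩
  rw [← norm_gradient_sub_gradient]
  exact h x hx v hv ξ

variable [IsManifold (𝓡 m) ∞ M] {R : TangentBundle (𝓡 m) M → M}

theorem norm_fderiv_pullback_zero (hR : IsRetraction R) (hd : DifferentiableInM (m := m) f)
    (x : M) (ξ : Ω) :
    ‖fderiv ℝ (fun w : TangentSpace (𝓡 m) x => f (R ⟨x, w⟩) ξ) 0‖
      = ‖rgrad (m := m) (fun y => f y ξ) x‖ := by
  rw [fderiv_pullback_zero hR (hd ξ x), norm_differential]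

/-- The size at the origin plus the Lipschitz growth bounds the derivative on a ball uniformly in
`ξ`; this is the domination needed under the integral sign. -/
theorem exists_bound_fderiv_pullback (hR : IsRetraction R) (hd : DifferentiableInM (m := m) f)
    (hg : LocallyBounded (fun x ξ => ‖rgrad (m := m) (fun y => f y ξ) x‖))
    (hlip : LocallyRLipschitzGradient R f) (x : M) {r : ℝ} (hr : 0 < r) :
    ∃ B, ∀ v : TangentSpace (𝓡 m) x, ‖v‖ < r → ∀ ξ,
      ‖fderiv ℝ (fun w : TangentSpace (𝓡 m) x => f (R ⟨x, w⟩) ξ) v‖ ≤ B := by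
  obtain ⟨C, hC, h1⟩ := norm_fderiv_pullback_sub f R hlip (isCompact_singleton (x := x)) hr
  obtain ⟨D, hD, h2⟩ := hg {x} isCompact_singleton
  refine ⟨C * r + D, fun v hv ξ => ?_⟩
  have e1 := h1 x rfl v hv.le ξ
  have e2 : ‖rgrad (m := m) (fun y => f y ξ) x‖ ≤ D := by simpa using h2 x rfl ξ
  have e3 := norm_fderiv_pullback_zero hR hd x ξ
  have e4 := norm_le_norm_sub_add (fderiv ℝ (fun w : TangentSpace (𝓡 m) x => f (R ⟨x, w⟩) ξ) v)
    (fderiv ℝ (fun w : TangentSpace (𝓡 m) x => f (R ⟨x, w⟩) ξ) 0)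
  have e5 : C * ‖v‖ ≤ C * r := by gcongr
  linarith

variable [MeasurableSpace Ω] {μ : Measure Ω} [IsProbabilityMeasure μ] {F : M → ℝ}

/-- The pullback of the mean function is differentiable, under the integral sign. -/
theorem mean_pullback (hR : IsRetraction R) (hm : ∀ x, Measurable (f x))
    (hd : DifferentiableInM (m := m) f) (hb : LocallyBounded f)
    (hg : LocallyBounded (fun x ξ => ‖rgrad (m := m) (fun y => f y ξ) x‖))
    (hlip : LocallyRLipschitzGradient R f) (hF : ∀ x, F x = ∫ ξ, f x ξ ∂μ) (x : M) :
    Differentiable ℝ (fun w : TangentSpace (𝓡 m) x => F (R ⟨x, w⟩)) ∧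
    (∀ v u : TangentSpace (𝓡 m) x,
      Integrable (fun ξ => fderiv ℝ (fun w : TangentSpace (𝓡 m) x => f (R ⟨x, w⟩) ξ) v u) μ ∧
      fderiv ℝ (fun w : TangentSpace (𝓡 m) x => F (R ⟨x, w⟩)) v u
        = ∫ ξ, fderiv ℝ (fun w : TangentSpace (𝓡 m) x => f (R ⟨x, w⟩) ξ) v u ∂μ) ∧
    ∀ (v v' : TangentSpace (𝓡 m) x) (C : ℝ),
      (∀ ξ, ‖fderiv ℝ (fun w : TangentSpace (𝓡 m) x => f (R ⟨x, w⟩) ξ) v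
        - fderiv ℝ (fun w : TangentSpace (𝓡 m) x => f (R ⟨x, w⟩) ξ) v'‖ ≤ C) →
      ‖fderiv ℝ (fun w : TangentSpace (𝓡 m) x => F (R ⟨x, w⟩)) v
        - fderiv ℝ (fun w : TangentSpace (𝓡 m) x => F (R ⟨x, w⟩)) v'‖ ≤ C := by
  have : FiniteDimensional ℝ (TangentSpace (𝓡 m) x) := finiteDimensional_tangentSpace x
  simp only [hF]
  exact differentiable_integral_of_bounded (μ := μ)
    (g := fun (w : TangentSpace (𝓡 m) x) ξ => f (R ⟨x, w⟩) ξ) (fun w => hm _)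
    (fun w => integrable_of_locallyBounded hm hb _)
    (fun ξ => differentiable_pullback hR (hd ξ) x)
    fun r hr => exists_bound_fderiv_pullback hR hd hg hlip x hr

/-- The differential of the mean function is the mean of the differentials. -/
theorem differential_mean_apply (hR : IsRetraction R) (hm : ∀ x, Measurable (f x))
    (hd : DifferentiableInM (m := m) f) (hb : LocallyBounded f)
    (hg : LocallyBounded (fun x ξ => ‖rgrad (m := m) (fun y => f y ξ) x‖))
    (hlip : LocallyRLipschitzGradient R f) (hF : ∀ x, F x = ∫ ξ, f x ξ ∂μ) (x : M) :
    MDifferentiableAt (𝓡 m) 𝓘(ℝ, ℝ) F x ∧ ∀ v : TangentSpace (𝓡 m) x,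
      Integrable (fun ξ => differential (m := m) (fun y => f y ξ) x v) μ ∧
      differential F x v = ∫ ξ, differential (m := m) (fun y => f y ξ) x v ∂μ := by
  obtain ⟨h1, h2, -⟩ := mean_pullback hR hm hd hb hg hlip hF x
  have hFd := mdifferentiableAt_of_pullback hR (h1 0)
  refine ⟨hFd, fun v => ?_⟩
  have h3 := h2 0 v
  rw [fderiv_pullback_zero hR hFd] at h3
  have e : ∀ ξ, fderiv ℝ (fun w : TangentSpace (𝓡 m) x => f (R ⟨x, w⟩) ξ) 0
      = differential (m := m) (fun y => f y ξ) x := fun ξ => fderiv_pullback_zero hR (hd ξ x)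
  simpa only [e] using h3

theorem mdifferentiable_mean (hR : IsRetraction R) (hm : ∀ x, Measurable (f x))
    (hd : DifferentiableInM (m := m) f) (hb : LocallyBounded f)
    (hg : LocallyBounded (fun x ξ => ‖rgrad (m := m) (fun y => f y ξ) x‖))
    (hlip : LocallyRLipschitzGradient R f) (hF : ∀ x, F x = ∫ ξ, f x ξ ∂μ) :
    MDifferentiable (𝓡 m) 𝓘(ℝ, ℝ) F :=
  fun x => (differential_mean_apply hR hm hd hb hg hlip hF x).1

/-- The pullbacks of the mean function inherit the Lipschitz bound on the gradient. -/
theorem fderiv_mean_pullback_sub_le (hR : IsRetraction R) (hm : ∀ x, Measurable (f x))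
    (hd : DifferentiableInM (m := m) f) (hb : LocallyBounded f)
    (hg : LocallyBounded (fun x ξ => ‖rgrad (m := m) (fun y => f y ξ) x‖))
    (hlip : LocallyRLipschitzGradient R f) (hF : ∀ x, F x = ∫ ξ, f x ξ ∂μ)
    {K : Set M} (hK : IsCompact K) {r : ℝ} (hr : 0 < r) :
    ∃ C : ℝ, 0 < C ∧ ∀ x ∈ K, ∀ v : TangentSpace (𝓡 m) x, ‖v‖ ≤ r →
      ‖fderiv ℝ (fun w : TangentSpace (𝓡 m) x => F (R ⟨x, w⟩)) v
        - fderiv ℝ (fun w : TangentSpace (𝓡 m) x => F (R ⟨x, w⟩)) 0‖ ≤ C * ‖v‖ := by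
  obtain ⟨C, hC, h⟩ := norm_fderiv_pullback_sub f R hlip hK hr
  refine ⟨C, hC, fun x hx v hv => ?_⟩
  exact (mean_pullback hR hm hd hb hg hlip hF x).2.2 v 0 _ (h x hx v hv)

/-- The Lipschitz bound passes to the mean. Applied with `K = {x}` it makes the derivative of the
pullback continuous at `0_x`, and the local inverse of `R_x` transfers this to `M`. -/
theorem continuous_norm_rgrad_mean
    [IsContinuousRiemannianBundle (EuclideanSpace ℝ (Fin m)) (fun x : M => TangentSpace (𝓡 m) x)]
    (hR : IsRetraction R) (hm : ∀ x, Measurable (f x))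
    (hd : DifferentiableInM (m := m) f) (hb : LocallyBounded f)
    (hg : LocallyBounded (fun x ξ => ‖rgrad (m := m) (fun y => f y ξ) x‖))
    (hlip : LocallyRLipschitzGradient R f) (hF : ∀ x, F x = ∫ ξ, f x ξ ∂μ) :
    Continuous fun x => ‖rgrad (m := m) F x‖ := by
  refine continuous_iff_continuousAt.2 fun x => continuousAt_norm_rgrad
    (continuousAt_chartPartial hR (mdifferentiable_mean hR hm hd hb hg hlip hF) ?_)
  obtain ⟨C, -, hC⟩ := fderiv_mean_pullback_sub_le hR hm hd hb hg hlip hF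
    (isCompact_singleton (x := x)) one_pos
  exact continuousAt_fderiv_zero_of_norm_sub_le (hC x rfl)

/-- First-order expansion of the mean function along the retraction, uniform on compact sets. -/
theorem mean_expansion (hR : IsRetraction R) (hm : ∀ x, Measurable (f x))
    (hd : DifferentiableInM (m := m) f) (hb : LocallyBounded f)
    (hg : LocallyBounded (fun x ξ => ‖rgrad (m := m) (fun y => f y ξ) x‖))
    (hlip : LocallyRLipschitzGradient R f) (hF : ∀ x, F x = ∫ ξ, f x ξ ∂μ)
    {K : Set M} (hK : IsCompact K) {r : ℝ} (hr : 0 < r) :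
    ∃ C : ℝ, 0 < C ∧ ∀ x ∈ K, ∀ v : TangentSpace (𝓡 m) x, ‖v‖ ≤ r →
      |F (R ⟨x, v⟩) - F x - differential F x v| ≤ C * ‖v‖ ^ 2 := by
  obtain ⟨C, hC, h⟩ := fderiv_mean_pullback_sub_le hR hm hd hb hg hlip hF hK hr
  refine ⟨C, hC, fun x hx v hv => ?_⟩
  have hFd := mdifferentiable_mean hR hm hd hb hg hlip hF
  have := abs_sub_le_of_fderiv_lipschitz_zero (differentiable_pullback hR hFd x) hC.le (h x hx) hv
  rwa [fderiv_pullback_zero hR (hFd x), hR.map_zero] at this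

end MeanFunction

/-! ### Displacement along the retraction, uniform on compact sets. -/

section Displacement

variable {m : ℕ} {M : Type*} [TopologicalSpace M]
  [ChartedSpace (EuclideanSpace ℝ (Fin m)) M] [IsManifold (𝓡 m) ∞ M]

theorem extChartAt_tangentBundle_apply {y x : M}
    (hx : x ∈ (chartAt (EuclideanSpace ℝ (Fin m)) y).source) (v : TangentSpace (𝓡 m) x) :
    extChartAt (𝓡 m).tangent (⟨y, 0⟩ : TangentBundle (𝓡 m) M) ⟨x, v⟩
      = (extChartAt (𝓡 m) y x, (trivializationAt (EuclideanSpace ℝ (Fin m))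
          (TangentSpace (𝓡 m)) y).continuousLinearMapAt ℝ x v) := by
  have hx' : x ∈ (trivializationAt (EuclideanSpace ℝ (Fin m))
      (TangentSpace (𝓡 m)) y).baseSet := by
    rwa [TangentBundle.trivializationAt_baseSet]
  rw [FiberBundle.extChartAt, Trivialization.continuousLinearMapAt_apply_of_mem ℝ _ hx']
  rfl

variable [RiemannianBundle (fun x : M => TangentSpace (𝓡 m) x)]
  [IsContinuousRiemannianBundle (EuclideanSpace ℝ (Fin m)) (fun x : M => TangentSpace (𝓡 m) x)]
  {R : TangentBundle (𝓡 m) M → M}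

/-- Along short tangent vectors, the retraction moves the value of a `C¹` function by at most a
multiple of the length of the vector, locally uniformly in the base point. -/
theorem eventually_abs_retraction_sub_le (hR : IsRetraction R) {h : M → ℝ}
    (hh : ContMDiff (𝓡 m) 𝓘(ℝ, ℝ) 1 h) (y : M) :
    ∃ C > 0, ∃ ε > 0, ∀ᶠ x in 𝓝 y, ∀ v : TangentSpace (𝓡 m) x, ‖v‖ ≤ ε →
      |h (R ⟨x, v⟩) - h x| ≤ C * ‖v‖ := by
  set q : TangentBundle (𝓡 m) M := ⟨y, 0⟩ with hq
  set Ψ := extChartAt (𝓡 m).tangent q with hΨ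
  have hG : ContDiffAt ℝ 1 (fun p => h (R (Ψ.symm p))) (Ψ q) := by
    have := (contMDiffAt_iff.1 ((hh.comp hR.contMDiff) q)).2
    have hr : Set.range (𝓡 m).tangent = Set.univ := by
      simp [ModelWithCorners.tangent]
    rw [hr, contDiffWithinAt_univ] at this
    exact this
  -- In a bundle chart around the zero vector `h ∘ R` is `C¹`, hence locally Lipschitz.
  obtain ⟨L, s, hs, hL⟩ := hG.exists_lipschitzOnWith
  obtain ⟨C, hC, hT⟩ := eventually_norm_trivializationAt_lt (EuclideanSpace ℝ (Fin m))
    (fun x : M => TangentSpace (𝓡 m) x) y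
  have hy := mem_chart_source (EuclideanSpace ℝ (Fin m)) y
  rw [hΨ, hq, extChartAt_tangentBundle_apply hy, map_zero] at hs
  obtain ⟨δ, hδ, hball⟩ := Metric.mem_nhds_iff.1 hs
  have hφ : ∀ᶠ x in 𝓝 y, extChartAt (𝓡 m) y x ∈ Metric.ball (extChartAt (𝓡 m) y y) δ :=
    (continuousAt_extChartAt (I := 𝓡 m) y) (Metric.ball_mem_nhds _ hδ)
  -- `C` compares fibre coordinates with the Riemannian norm, so this radius keeps coordinates
  -- within `δ / 2`; `L + 1` replaces `L`, which may be `0`.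
  refine ⟨(L + 1) * C, by positivity, δ / (2 * C), by positivity, ?_⟩
  filter_upwards [hT, hφ, chart_source_mem_nhds (EuclideanSpace ℝ (Fin m)) y] with x hxT hxφ hxs v hv
  set T := (trivializationAt (EuclideanSpace ℝ (Fin m))
          (TangentSpace (𝓡 m)) y).continuousLinearMapAt ℝ x with hTdef
  have hTv : ‖T v‖ ≤ C * ‖v‖ := (T.le_opNorm v).trans (by gcongr)
  have hTδ : ‖T v‖ < δ := by
    refine hTv.trans_lt ?_
    calc C * ‖v‖ ≤ C * (δ / (2 * C)) := by gcongr
      _ = δ / 2 := by field_simp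
      _ < δ := by linarith
  have hmem : ∀ u : TangentSpace (𝓡 m) x, (⟨x, u⟩ : TangentBundle (𝓡 m) M) ∈ Ψ.source := by
    intro u
    rw [hΨ, extChartAt_source, TangentBundle.mem_chart_source_iff]
    exact hxs
  have e1 := Ψ.left_inv (hmem v)
  have e0 := Ψ.left_inv (hmem 0)
  have m1 : Ψ ⟨x, v⟩ = (extChartAt (𝓡 m) y x, T v) := extChartAt_tangentBundle_apply hxs v
  have m0 : Ψ ⟨x, 0⟩ = (extChartAt (𝓡 m) y x, 0) := by
    rw [hΨ, hq, extChartAt_tangentBundle_apply hxs, map_zero]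
  have s1 : Ψ ⟨x, v⟩ ∈ s := hball (by
    rw [m1, ← ball_prod_same]
    exact ⟨hxφ, by simpa using hTδ⟩)
  have s0 : Ψ ⟨x, 0⟩ ∈ s := hball (by
    rw [m0, ← ball_prod_same]
    exact ⟨hxφ, by simpa using hδ⟩)
  -- The points `(x, v)` and `(x, 0)` share their base coordinate, so their distance in the chart is
  -- just `‖T v‖`.
  have key := hL.dist_le_mul _ s1 _ s0
  rw [e1, e0, hR.map_zero, m1, m0, Real.dist_eq, Prod.dist_eq, dist_self, dist_zero_right,
    max_eq_right (norm_nonneg _)] at key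
  calc |h (R ⟨x, v⟩) - h x| ≤ L * ‖T v‖ := key
    _ ≤ (L + 1) * (C * ‖v‖) := by gcongr; linarith
    _ = (L + 1) * C * ‖v‖ := by ring

/-- Compactness induction: local constants combine on a union through `max C C'` and `min ε ε'`. -/
theorem exists_abs_retraction_sub_le (hR : IsRetraction R) {h : M → ℝ}
    (hh : ContMDiff (𝓡 m) 𝓘(ℝ, ℝ) 1 h) {K : Set M} (hK : IsCompact K) :
    ∃ C > 0, ∃ ε > 0, ∀ x ∈ K, ∀ v : TangentSpace (𝓡 m) x, ‖v‖ ≤ ε →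
      |h (R ⟨x, v⟩) - h x| ≤ C * ‖v‖ := by
  refine hK.induction_on (p := fun K => ∃ C > 0, ∃ ε > 0, ∀ x ∈ K,
    ∀ v : TangentSpace (𝓡 m) x, ‖v‖ ≤ ε → |h (R ⟨x, v⟩) - h x| ≤ C * ‖v‖)
    ⟨1, one_pos, 1, one_pos, by simp⟩ ?_ ?_ ?_
  · rintro s t hst ⟨C, hC, ε, hε, H⟩
    exact ⟨C, hC, ε, hε, fun x hx => H x (hst hx)⟩
  · rintro s t ⟨C, hC, ε, hε, H⟩ ⟨C', hC', ε', hε', H'⟩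
    refine ⟨max C C', lt_max_of_lt_left hC, min ε ε', lt_min hε hε', ?_⟩
    rintro x (hx | hx) v hv
    · exact (H x hx v (hv.trans (min_le_left _ _))).trans (by gcongr; exact le_max_left _ _)
    · exact (H' x hx v (hv.trans (min_le_right _ _))).trans (by gcongr; exact le_max_right _ _)
  · intro x _
    obtain ⟨C, hC, ε, hε, H⟩ := eventually_abs_retraction_sub_le hR hh x
    exact ⟨_, mem_nhdsWithin_of_mem_nhds H, C, hC, ε, hε, fun _ hx => hx⟩

end Displacement

/-! ### Convergence of almost supermartingales. -/

section Probability

/-- Conditional expectation of a function of a known variable and an independent one. -/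
theorem condExp_of_indep {S Ω Z : Type*} [MeasurableSpace Ω] [MeasurableSpace Z]
    {m m0 : MeasurableSpace S} {P : Measure S} [IsProbabilityMeasure P] (hm : m ≤ m0) {ξ : S → Ω} (hξ : Measurable ξ) {z : S → Z}
    (hz : Measurable[m] z)
    (hind : Indep m (MeasurableSpace.comap ξ inferInstance) P) {Ψ : Z × Ω → ℝ}
    (hΨ : Measurable Ψ) {C : ℝ} (hb : ∀ s ω', |Ψ (z s, ω')| ≤ C) :
    P[fun s => Ψ (z s, ξ s) | m] =ᵐ[P] fun s => ∫ ω', Ψ (z s, ω') ∂(P.map ξ) := by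
  have hz0 : Measurable z := hz.mono hm le_rfl
  have : IsProbabilityMeasure (P.map ξ) := Measure.isProbabilityMeasure_map hξ.aemeasurable
  have hint : Integrable (fun s => Ψ (z s, ξ s)) P :=
    Integrable.of_bound (hΨ.comp (hz0.prodMk hξ)).aestronglyMeasurable C
      (ae_of_all _ fun s => hb _ _)
  have hmean : StronglyMeasurable fun y => ∫ ω', Ψ (y, ω') ∂(P.map ξ) :=
    hΨ.stronglyMeasurable.integral_prod_right'
  have hmb : ∀ s, ‖∫ ω', Ψ (z s, ω') ∂(P.map ξ)‖ ≤ C := fun s => by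
    simpa using norm_integral_le_of_norm_le_const (μ := P.map ξ) (f := fun ω' => Ψ (z s, ω'))
      (ae_of_all _ fun ω' => hb s ω')
  refine (ae_eq_condExp_of_forall_setIntegral_eq hm hint (fun A _ _ => ?_) (fun A hA _ => ?_)
    ?_).symm
  · exact (Integrable.of_bound (hmean.comp_measurable hz0).aestronglyMeasurable C
      (ae_of_all _ fun s => hmb _)).integrableOn
  · have hA0 := hm A hA
    -- Carrying the indicator of `A` along with `z` makes the integral over `A` an integral against
    -- the product law of `W` and `ξ`, where Fubini applies.
    let W : S → ℝ × Z := fun s => (A.indicator (fun _ => (1 : ℝ)) s, z s)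
    have hW : Measurable[m] W := (measurable_const.indicator hA).prodMk hz
    have hW0 : Measurable W := hW.mono hm le_rfl
    have hWξ : IndepFun W ξ P := by
      rw [IndepFun_iff_Indep]
      exact indep_of_indep_of_le_left hind hW.comap_le
    have hlaw := (indepFun_iff_map_prod_eq_prod_map_map hW0.aemeasurable hξ.aemeasurable).1 hWξ
    have : IsProbabilityMeasure (P.map W) := Measure.isProbabilityMeasure_map hW0.aemeasurable
    have hC0 : 0 ≤ C := (norm_nonneg _).trans (hmb (Classical.choice P.nonempty_of_neZero))
    have hG : Measurable fun p : (ℝ × Z) × Ω => p.1.1 * Ψ (p.1.2, p.2) := by fun_prop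
    have hGi : Integrable (fun p : (ℝ × Z) × Ω => p.1.1 * Ψ (p.1.2, p.2))
        ((P.map W).prod (P.map ξ)) := by
      rw [← hlaw, integrable_map_measure hG.aestronglyMeasurable (hW0.prodMk hξ).aemeasurable]
      refine Integrable.of_bound (hG.comp (hW0.prodMk hξ)).aestronglyMeasurable C
        (ae_of_all _ fun s => ?_)
      by_cases hs : s ∈ A
      · simpa [W, hs] using hb s (ξ s)
      · simpa [W, hs] using hC0
    have e1 : ∫ s in A, Ψ (z s, ξ s) ∂P
        = ∫ p, p.1.1 * Ψ (p.1.2, p.2) ∂((P.map W).prod (P.map ξ)) := by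
      rw [← hlaw, integral_map (hW0.prodMk hξ).aemeasurable hG.aestronglyMeasurable,
        ← integral_indicator hA0]
      refine integral_congr_ae (ae_of_all _ fun s => ?_)
      by_cases hs : s ∈ A <;> simp [W, hs]
    rw [e1, integral_prod _ hGi, integral_map hW0.aemeasurable
      (hG.stronglyMeasurable.integral_prod_right').aestronglyMeasurable, ← integral_indicator hA0]
    refine integral_congr_ae (ae_of_all _ fun s => ?_)
    by_cases hs : s ∈ A <;> simp [W, hs]
  · exact (hmean.measurable.comp hz).stronglyMeasurable.aestronglyMeasurable

variable {S : Type*} {m0 : MeasurableSpace S} {P : Measure S} [IsProbabilityMeasure P]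

variable {ℱ : Filtration ℕ m0}

/-- Martingale increments are orthogonal to the past, so second moments add up. The almost sure
bound `B` is part of the induction because it makes the cross term integrable. -/
theorem integral_sq_martingale_le {N : ℕ → S → ℝ} (hN : Martingale N ℱ P) {d : ℕ → ℝ} {D : ℝ}
    (h0 : ∀ s, |N 0 s| ≤ D) (hd : ∀ n, ∀ᵐ s ∂P, |N (n + 1) s - N n s| ≤ d n) (n : ℕ) :
    (∃ B, ∀ᵐ s ∂P, |N n s| ≤ B) ∧
      ∫ s, N n s ^ 2 ∂P ≤ D ^ 2 + ∑ i ∈ Finset.range n, d i ^ 2 := by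
  have hsm : ∀ n, AEStronglyMeasurable (N n) P := fun n => (hN.integrable n).aestronglyMeasurable
  induction n with
  | zero =>
    refine ⟨⟨D, ae_of_all _ h0⟩, ?_⟩
    have hle : ∀ s, N 0 s ^ 2 ≤ D ^ 2 := fun s => by
      rw [← sq_abs]; exact pow_le_pow_left₀ (abs_nonneg _) (h0 s) 2
    have := integral_mono_of_nonneg (μ := P) (ae_of_all _ fun s => sq_nonneg (N 0 s))
      (integrable_const (D ^ 2)) (ae_of_all _ hle)
    simpa using this
  | succ n ih =>
    obtain ⟨⟨B, hB⟩, ih⟩ := ih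
    set Δ : S → ℝ := fun s => N (n + 1) s - N n s with hΔ
    have hΔm : AEStronglyMeasurable Δ P := (hsm _).sub (hsm _)
    have hΔi : Integrable Δ P := (hN.integrable _).sub (hN.integrable _)
    have iN : Integrable (fun s => N n s ^ 2) P := by
      refine Integrable.of_bound ((hsm n).pow 2) (B ^ 2) ?_
      filter_upwards [hB] with s hs
      rw [norm_pow]
      exact pow_le_pow_left₀ (norm_nonneg _) hs 2
    have iD : Integrable (fun s => Δ s ^ 2) P := by
      refine Integrable.of_bound (hΔm.pow 2) (d n ^ 2) ?_
      filter_upwards [hd n] with s hs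
      rw [norm_pow]
      exact pow_le_pow_left₀ (norm_nonneg _) hs 2
    have iX : Integrable (N n * Δ) P := hΔi.bdd_mul (c := B) (hsm n) hB
    have hX : ∫ s, N n s * Δ s ∂P = 0 := by
      have e1 : P[N n * Δ | ℱ n] =ᵐ[P] N n * P[Δ | ℱ n] :=
        condExp_mul_of_stronglyMeasurable_left (hN.stronglyAdapted n) iX hΔi
      have e2 : P[Δ | ℱ n] =ᵐ[P] 0 := by
        have h1 : P[Δ | ℱ n] =ᵐ[P] P[N (n + 1) | ℱ n] - P[N n | ℱ n] :=
          condExp_sub (hN.integrable _) (hN.integrable _) _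
        filter_upwards [h1, hN.condExp_ae_eq (Nat.le_succ n), hN.condExp_ae_eq (le_refl n)]
          with s a b c
        rw [a, Pi.sub_apply, b, c]
        simp
      have e3 : ∫ s, (N n * Δ) s ∂P = ∫ s, (P[N n * Δ | ℱ n]) s ∂P :=
        (integral_condExp (ℱ.le n)).symm
      have e4 : P[N n * Δ | ℱ n] =ᵐ[P] 0 := by
        filter_upwards [e1, e2] with s a b
        rw [a, Pi.mul_apply, b]
        simp
      rw [integral_congr_ae e4] at e3
      simpa using e3
    refine ⟨⟨B + d n, ?_⟩, ?_⟩
    · filter_upwards [hB, hd n] with s a b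
      have := abs_add_le (N n s) (N (n + 1) s - N n s)
      rw [add_sub_cancel] at this
      linarith
    · have e : ∀ s, N (n + 1) s ^ 2 = N n s ^ 2 + 2 * (N n s * Δ s) + Δ s ^ 2 := fun s => by
        simp only [hΔ]; ring
      have i2 : Integrable (fun s => 2 * (N n s * Δ s)) P := iX.const_mul 2
      simp only [e]
      have i3 : Integrable (fun s => N n s ^ 2 + 2 * (N n s * Δ s)) P := iN.add i2
      rw [integral_add i3 iD, integral_add iN i2, integral_const_mul, hX,
        Finset.sum_range_succ]
      have : ∫ s, Δ s ^ 2 ∂P ≤ d n ^ 2 := by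
        have := integral_mono_of_nonneg (μ := P) (ae_of_all _ fun s => sq_nonneg (Δ s))
          (integrable_const (d n ^ 2)) (by
            filter_upwards [hd n] with s hs
            rw [← sq_abs]; exact pow_le_pow_left₀ (abs_nonneg _) hs 2)
        simpa using this
      linarith

/-- A martingale whose increments are bounded by a square-summable sequence converges. -/
theorem martingale_ae_tendsto_of_sq_summable {N : ℕ → S → ℝ} (hN : Martingale N ℱ P) {d : ℕ → ℝ}
    {D : ℝ} (h0 : ∀ s, |N 0 s| ≤ D) (hd : ∀ n, ∀ᵐ s ∂P, |N (n + 1) s - N n s| ≤ d n)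
    (hds : Summable fun n => d n ^ 2) :
    ∀ᵐ s ∂P, ∃ l, Tendsto (fun n => N n s) atTop (𝓝 l) := by
  refine hN.submartingale.exists_ae_tendsto_of_bdd
    (R := (1 + (D ^ 2 + ∑' n, d n ^ 2)).toNNReal) fun n => ?_
  obtain ⟨⟨B, hB⟩, h2⟩ := integral_sq_martingale_le hN h0 hd n
  have iN : Integrable (fun s => N n s ^ 2) P := by
    refine Integrable.of_bound ((hN.integrable n).aestronglyMeasurable.pow 2) (B ^ 2) ?_
    filter_upwards [hB] with s hs
    rw [norm_pow]
    exact pow_le_pow_left₀ (norm_nonneg _) hs 2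
  rw [eLpNorm_one_eq_lintegral_enorm, ← ofReal_integral_norm_eq_lintegral_enorm (hN.integrable n)]
  refine ENNReal.ofReal_le_ofReal ?_
  -- The inequality `|u| ≤ 1 + u²` turns the `L²` bound into the `L¹` bound required for
  -- submartingale convergence.
  calc ∫ s, ‖N n s‖ ∂P ≤ ∫ s, (1 + N n s ^ 2) ∂P := by
        refine integral_mono (hN.integrable n).norm ((integrable_const 1).add iN) fun s => ?_
        rw [Real.norm_eq_abs, ← sq_abs]
        nlinarith [sq_nonneg (|N n s| - 1), abs_nonneg (N n s)]
    _ = 1 + ∫ s, N n s ^ 2 ∂P := by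
        rw [integral_add (integrable_const 1) iN]; simp
    _ ≤ 1 + (D ^ 2 + ∑' n, d n ^ 2) := by
        have := hds.sum_le_tsum (Finset.range n) fun _ _ => sq_nonneg _
        linarith

/-- Deterministic core of the almost-supermartingale convergence: a bounded sequence whose drift is
at most `-g n + e n`, up to a convergent sequence, converges and `g` is summable. -/
theorem tendsto_and_summable_of_drift {Y N A g e : ℕ → ℝ} (hY : ∀ n, Y n = N n + A n) {D l : ℝ}
    (hb : ∀ n, |Y n| ≤ D) (hN : Tendsto N atTop (𝓝 l))
    (hA : ∀ n, A (n + 1) - A n ≤ -g n + e n) (hg : ∀ n, 0 ≤ g n) (he0 : ∀ n, 0 ≤ e n)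
    (he : Summable e) :
    (∃ L, Tendsto Y atTop (𝓝 L)) ∧ Summable g := by
  obtain ⟨B, hB⟩ := hN.bddAbove_range
  have hsum : ∀ n, A n ≤ A 0 - ∑ i ∈ Finset.range n, g i + ∑ i ∈ Finset.range n, e i := by
    intro n
    induction n with
    | zero => simp
    | succ n ih => rw [Finset.sum_range_succ, Finset.sum_range_succ]; linarith [hA n]
  have hlow : ∀ n, -D - B ≤ A n := fun n => by
    have h1 := (abs_le.1 (hb n)).1
    have h2 : N n ≤ B := hB ⟨n, rfl⟩
    linarith [hY n]
  have hgs : Summable g := by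
    refine summable_of_sum_range_le hg (c := A 0 + ∑' i, e i + D + B) fun n => ?_
    have := he.sum_le_tsum (Finset.range n) fun i _ => he0 i
    linarith [hsum n, hlow n]
  refine ⟨?_, hgs⟩
  -- Removing the accumulated errors leaves a nonincreasing sequence, bounded below because `Y` is
  -- bounded and `N` is bounded above.
  have hanti : Antitone fun n => A n - ∑ i ∈ Finset.range n, e i :=
    antitone_nat_of_succ_le fun n => by
      rw [Finset.sum_range_succ]; linarith [hA n, hg n]
  have hbdd : BddBelow (Set.range fun n => A n - ∑ i ∈ Finset.range n, e i) := by
    refine ⟨-D - B - ∑' i, e i, ?_⟩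
    rintro _ ⟨n, rfl⟩
    have := he.sum_le_tsum (Finset.range n) fun i _ => he0 i
    show _ ≤ A n - _
    linarith [hlow n]
  have h1 := tendsto_atTop_ciInf hanti hbdd
  refine ⟨_, ((hN.add h1).add he.hasSum.tendsto_sum_nat).congr fun n => ?_⟩
  rw [hY]; ring

/-- A bounded adapted process with increments of order `d n` and conditional drift at most
`-g n + C d n ^ 2`, where `d` is square summable, converges almost surely, and `g` is almost surely
summable. -/
theorem ae_tendsto_and_summable_of_condExp_drift {Y : ℕ → S → ℝ} (hY : StronglyAdapted ℱ Y)
    {D : ℝ} (hD : ∀ n s, |Y n s| ≤ D) {d : ℕ → ℝ}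
    (hd : ∀ n s, |Y (n + 1) s - Y n s| ≤ d n) (hds : Summable fun n => d n ^ 2)
    {g : ℕ → S → ℝ} (hg : ∀ n s, 0 ≤ g n s) {C : ℝ} (hC : 0 ≤ C)
    (hdrift : ∀ n, ∀ᵐ s ∂P, (P[Y (n + 1) - Y n | ℱ n]) s ≤ -g n s + C * d n ^ 2) :
    ∀ᵐ s ∂P, (∃ L, Tendsto (fun n => Y n s) atTop (𝓝 L)) ∧ Summable fun n => g n s := by
  have hYi : ∀ n, Integrable (Y n) P := fun n =>
    Integrable.of_bound ((hY n).mono (ℱ.le n)).aestronglyMeasurable D (ae_of_all _ (hD n))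
  have hmart : Martingale (martingalePart Y ℱ P) ℱ P := martingale_martingalePart hY hYi
  have hpred : ∀ n s, predictablePart Y ℱ P (n + 1) s - predictablePart Y ℱ P n s
      = (P[Y (n + 1) - Y n | ℱ n]) s := fun n s => by
    simp [predictablePart, Finset.sum_range_succ]
  have hsplit : ∀ n s, Y n s = martingalePart Y ℱ P n s + predictablePart Y ℱ P n s := fun n s => by
    simp [martingalePart]
  -- The factor `2` covers the increment of `Y` and its conditional expectation, each at most `d n`.
  have hinc : ∀ n, ∀ᵐ s ∂P,
      |martingalePart Y ℱ P (n + 1) s - martingalePart Y ℱ P n s| ≤ 2 * d n := fun n => by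
    have h1 : ∀ᵐ s ∂P, |(P[Y (n + 1) - Y n | ℱ n]) s| ≤ d n := by
      exact ae_bdd_abs_condExp_of_ae_bdd_abs (ae_of_all _ fun s => hd n s)
    filter_upwards [h1] with s hs
    have e : martingalePart Y ℱ P (n + 1) s - martingalePart Y ℱ P n s
        = (Y (n + 1) s - Y n s) - (P[Y (n + 1) - Y n | ℱ n]) s := by
      linarith [hpred n s, hsplit n s, hsplit (n + 1) s]
    rw [e]
    exact (abs_sub _ _).trans (by linarith [hd n s])
  have hconv := martingale_ae_tendsto_of_sq_summable hmart (d := fun n => 2 * d n)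
    (by simpa using hD 0) hinc (by simpa [mul_pow] using hds.mul_left (2 ^ 2))
  filter_upwards [hconv, ae_all_iff.2 hdrift] with s ⟨l, hl⟩ hs
  exact tendsto_and_summable_of_drift (fun n => hsplit n s) (fun n => hD n s) hl
    (fun n => (hpred n s).trans_le (hs n)) (fun n => hg n s)
    (fun n => mul_nonneg hC (sq_nonneg _)) (hds.mul_left C)

end Probability

/-! ### Cluster points are stationary. -/

section Stationarity

/-- If the weights `c` have infinite sum but `∑ c g ^ 2` converges, and a bump function around
`y`, supported where `g ≥ η`, varies by at most a multiple of `c` along the sequence `x`,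
then `y` is not a cluster point of `x`. -/
theorem not_mapClusterPt_of_bump {X : Type*} [TopologicalSpace X] {x : ℕ → X} {c : ℕ → ℝ}
    (hc : ∀ t, 0 < c t) (hc_sum : Tendsto (fun n => ∑ t ∈ Finset.range n, c t) atTop atTop)
    {g : X → ℝ} (hg : Summable fun t => c t * g (x t) ^ 2) {y : X} {h : X → ℝ}
    (hcont : Continuous h) (hy : h y = 1) {η : ℝ} (hη : 0 < η)
    (hsupp : ∀ z, h z ≠ 0 → η ≤ g z) {L : ℝ}
    (hstep : ∀ᶠ t in atTop, |h (x (t + 1)) - h (x t)| ≤ L * c t) :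
    ¬ MapClusterPt y atTop x := by
  intro hcl
  obtain ⟨T₀, hT₀⟩ := eventually_atTop.1 hstep
  have hL : 0 ≤ L := by
    have := (abs_nonneg _).trans (hT₀ T₀ le_rfl)
    exact nonneg_of_mul_nonneg_left this (hc T₀)
  -- With a tail below this value, the weights spent where `g ≥ η` total less than `1 / (4(L+1))`,
  -- so `h` loses at most `1/4`.
  have hδ : 0 < η ^ 2 / (4 * (L + 1)) := by positivity
  obtain ⟨T₁, hT₁⟩ := eventually_atTop.1
    ((tendsto_sum_nat_add fun t => c t * g (x t) ^ 2).eventually (gt_mem_nhds hδ))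
  have hfreq : ∃ᶠ t in atTop, 1 / 2 < h (x t) := by
    have : ∀ᶠ z in 𝓝 y, 1 / 2 < h z :=
      hcont.continuousAt.eventually (lt_mem_nhds (by rw [hy]; norm_num))
    exact hcl.frequently this
  obtain ⟨t, ht, hxt⟩ := (frequently_atTop.1 hfreq) (max T₀ T₁)
  have htail : ∑' k, c (k + t) * g (x (k + t)) ^ 2 < η ^ 2 / (4 * (L + 1)) :=
    hT₁ t ((le_max_right _ _).trans ht)
  have hgt : Summable fun k => c (k + t) * g (x (k + t)) ^ 2 :=
    (summable_nat_add_iff t).2 hg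
  have hnn : ∀ k, 0 ≤ c (k + t) * g (x (k + t)) ^ 2 := fun k =>
    mul_nonneg (hc _).le (sq_nonneg _)
  have key : ∀ n, (∀ k < n, h (x (k + t)) ≠ 0) →
      η ^ 2 * ∑ k ∈ Finset.range n, c (k + t) < η ^ 2 / (4 * (L + 1)) := by
    intro n hn
    refine lt_of_le_of_lt ?_ ((hgt.sum_le_tsum (Finset.range n) fun k _ => hnn k).trans_lt htail)
    rw [Finset.mul_sum]
    refine Finset.sum_le_sum fun k hk => ?_
    rw [mul_comm]
    refine mul_le_mul_of_nonneg_left ?_ (hc _).le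
    exact pow_le_pow_left₀ hη.le (hsupp _ (hn k (Finset.mem_range.1 hk))) 2
  -- Starting above `1/2` and losing at most `1/4`, the bump never vanishes; the induction needs
  -- both facts, since the loss is bounded only while `h ≠ 0`.
  have hstay : ∀ n, (∀ k < n, h (x (k + t)) ≠ 0) ∧
      h (x t) - L * ∑ k ∈ Finset.range n, c (k + t) ≤ h (x (n + t)) := by
    intro n
    induction n with
    | zero => simp
    | succ n ih =>
      obtain ⟨ih1, ih2⟩ := ih
      have hs := key n ih1
      have hs' : L * ∑ k ∈ Finset.range n, c (k + t) ≤ 1 / 4 := by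
        have h0 : 0 ≤ ∑ k ∈ Finset.range n, c (k + t) := Finset.sum_nonneg fun k _ => (hc _).le
        rw [div_eq_mul_inv, mul_lt_mul_iff_right₀ (by positivity), ← one_div,
          lt_div_iff₀ (by positivity)] at hs
        nlinarith
      have hne : h (x (n + t)) ≠ 0 := by
        have : 0 < h (x (n + t)) := by linarith
        exact this.ne'
      refine ⟨fun k hk => ?_, ?_⟩
      · rcases Nat.lt_succ_iff_lt_or_eq.1 hk with hk | rfl
        · exact ih1 k hk
        · exact hne
      · have := (abs_le.1 (hT₀ (n + t) (((le_max_left _ _).trans ht).trans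
          (Nat.le_add_left t n)))).1
        rw [Finset.sum_range_succ, mul_add, show n + 1 + t = n + t + 1 by ring]
        linarith
  have hbound : ∀ n, ∑ k ∈ Finset.range n, c (k + t) ≤ 1 / (4 * (L + 1)) := fun n => by
    have hs := key n (hstay n).1
    rw [div_eq_mul_inv, mul_lt_mul_iff_right₀ (by positivity), ← one_div] at hs
    exact hs.le
  have hcs : Summable fun k => c (k + t) :=
    summable_of_sum_range_le (fun k => (hc _).le) hbound
  exact not_tendsto_atTop_of_tendsto_nhds ((summable_nat_add_iff t).1 hcs).hasSum.tendsto_sum_nat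
    hc_sum

variable {m : ℕ} {M : Type*} [TopologicalSpace M] [T2Space M]
  [ChartedSpace (EuclideanSpace ℝ (Fin m)) M] [IsManifold (𝓡 m) ∞ M]

theorem exists_contMDiff_bump {U : Set M} {y : M} (hU : U ∈ 𝓝 y) :
    ∃ h : M → ℝ, ContMDiff (𝓡 m) 𝓘(ℝ, ℝ) 1 h ∧ h y = 1 ∧ ∀ z, h z ≠ 0 → z ∈ U := by
  obtain ⟨χ, -, hχ⟩ := (SmoothBumpFunction.nhds_basis_support (I := 𝓡 m) hU).mem_iff.1 hU
  exact ⟨χ, χ.contMDiff.of_le (by exact_mod_cast le_top), χ.eq_one, fun z hz => hχ hz⟩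

variable [RiemannianBundle (fun x : M => TangentSpace (𝓡 m) x)]
  [IsContinuousRiemannianBundle (EuclideanSpace ℝ (Fin m)) (fun x : M => TangentSpace (𝓡 m) x)]
  {R : TangentBundle (𝓡 m) M → M}

/-- Cluster points of a retraction sequence in a compact set with steps of order `c` are zeros of
any continuous nonnegative `g` with `∑ c g ^ 2 < ∞`. -/
theorem eq_zero_of_mapClusterPt (hR : IsRetraction R) {K : Set M} (hK : IsCompact K)
    {x : ℕ → M} (hxK : ∀ t, x t ∈ K) {v : ∀ t, TangentSpace (𝓡 m) (x t)}
    (hx : ∀ t, x (t + 1) = R ⟨x t, v t⟩) {c : ℕ → ℝ} (hc : ∀ t, 0 < c t)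
    (hc_sum : Tendsto (fun n => ∑ t ∈ Finset.range n, c t) atTop atTop)
    (hc0 : Tendsto c atTop (𝓝 0)) {D : ℝ} (hv : ∀ t, ‖v t‖ ≤ D * c t) {g : M → ℝ}
    (hgc : Continuous g) (hg0 : ∀ z, 0 ≤ g z) (hg : Summable fun t => c t * g (x t) ^ 2) {y : M}
    (hy : MapClusterPt y atTop x) : g y = 0 := by
  by_contra hne
  have hpos : 0 < g y := lt_of_le_of_ne (hg0 y) (Ne.symm hne)
  obtain ⟨h, hh, hhy, hsupp⟩ := exists_contMDiff_bump (m := m) (U := {z | g y / 2 ≤ g z}) (y := y)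
    (hgc.continuousAt.eventually (le_mem_nhds (by linarith)))
  obtain ⟨C, hC, ε, hε, H⟩ := exists_abs_retraction_sub_le hR hh hK
  refine not_mapClusterPt_of_bump hc hc_sum hg hh.continuous hhy (half_pos hpos) hsupp
    (L := C * D) ?_ hy
  have hsmall : ∀ᶠ t in atTop, D * c t ≤ ε := by
    have : Tendsto (fun t => D * c t) atTop (𝓝 0) := by simpa using hc0.const_mul D
    exact this.eventually (ge_mem_nhds hε)
  filter_upwards [hsmall] with t ht
  rw [hx t]
  refine (H _ (hxK t) _ ((hv t).trans ht)).trans ?_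
  rw [mul_assoc]
  exact mul_le_mul_of_nonneg_left (hv t) hC.le

/-- The values lie in the compact set `g '' K`, and an ultrafilter realizing a cluster value of `g ∘
x` converges along `x` to a point of `K`, so that value is `g` at a cluster point. -/
theorem tendsto_zero_of_mapClusterPt {X : Type*} [TopologicalSpace X] {K : Set X}
    (hK : IsCompact K) {x : ℕ → X} (hxK : ∀ t, x t ∈ K) {g : X → ℝ} (hgc : Continuous g)
    (h : ∀ y, MapClusterPt y atTop x → g y = 0) : Tendsto (fun t => g (x t)) atTop (𝓝 0) := by
  refine (hK.image hgc).tendsto_nhds_of_unique_mapClusterPt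
    (Eventually.of_forall fun t => ⟨x t, hxK t, rfl⟩) fun r _ hr => ?_
  obtain ⟨U, hU, hUr⟩ := mapClusterPt_iff_ultrafilter.1 hr
  obtain ⟨y, -, hy⟩ := hK.ultrafilter_le_nhds (U.map x)
    (le_principal_iff.2 (Eventually.of_forall (f := (U : Filter ℕ)) hxK))
  have hy' : Tendsto x U (𝓝 y) := hy
  have e := h y (mapClusterPt_iff_ultrafilter.2 ⟨U, hU, hy'⟩)
  exact (tendsto_nhds_unique hUr ((hgc.tendsto y).comp hy')).trans e

end Stationarity

/-! ### The stochastic iteration: filtration, drift and summability. -/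

section Iteration

section Past

variable {S Ω : Type*} {m0 : MeasurableSpace S} [MeasurableSpace Ω]

/-- The data `(φ₀, …, φ_t, ξ₀, …, ξ_{t-1})` available when step `t` is taken. -/
def pastData (φ : ℕ → S → ℝ) (ξ : ℕ → S → Ω) (t : ℕ) (s : S) :
    (Set.Iic t → ℝ) × (Set.Iio t → Ω) :=
  (fun i => φ i s, fun i => ξ i s)

variable {φ : ℕ → S → ℝ} {ξ : ℕ → S → Ω}

theorem measurable_pastData_of_le {t : ℕ} {m : MeasurableSpace S}
    (hφ : ∀ i ≤ t, Measurable[m] (φ i)) (hξ : ∀ i < t, Measurable[m] (ξ i)) :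
    Measurable[m] (pastData φ ξ t) :=
  Measurable.prodMk (measurable_pi_lambda _ fun i => hφ i i.2)
    (measurable_pi_lambda _ fun i => hξ i i.2)

theorem measurable_factor_pastData {t i : ℕ} (hi : i ≤ t) :
    Measurable[MeasurableSpace.comap (pastData φ ξ t) inferInstance] (φ i) :=
  ((measurable_pi_apply (⟨i, hi⟩ : Set.Iic t)).comp measurable_fst).comp
    (comap_measurable (pastData φ ξ t))

theorem measurable_sample_pastData {t i : ℕ} (hi : i < t) :
    Measurable[MeasurableSpace.comap (pastData φ ξ t) inferInstance] (ξ i) :=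
  ((measurable_pi_apply (⟨i, hi⟩ : Set.Iio t)).comp measurable_snd).comp
    (comap_measurable (pastData φ ξ t))

/-- The filtration generated by the data available at each step. -/
def pastFiltration (φ : ℕ → S → ℝ) (ξ : ℕ → S → Ω) (hφ : ∀ t, Measurable (φ t))
    (hξ : ∀ t, Measurable (ξ t)) : Filtration ℕ m0 where
  seq t := MeasurableSpace.comap (pastData φ ξ t) inferInstance
  mono' _ _ hij := Measurable.comap_le (measurable_pastData_of_le
    (fun _ hk => measurable_factor_pastData (hk.trans hij))
    (fun _ hk => measurable_sample_pastData (hk.trans_le hij)))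
  le' _ := Measurable.comap_le (measurable_pastData_of_le (fun _ _ => hφ _) (fun _ _ => hξ _))

end Past

variable {m : ℕ} {M : Type*} [TopologicalSpace M]
  [ChartedSpace (EuclideanSpace ℝ (Fin m)) M] [IsManifold (𝓡 m) ∞ M]
  [RiemannianBundle (fun x : M => TangentSpace (𝓡 m) x)]
  [IsContinuousRiemannianBundle (EuclideanSpace ℝ (Fin m)) (fun x : M => TangentSpace (𝓡 m) x)]
  {Ω : Type*} [MeasurableSpace Ω] {f : M → Ω → ℝ} {R : TangentBundle (𝓡 m) M → M}

/-- The scale is absorbed into the random parameter: `τ ∇f_ω` is the gradient of `τ f_ω`, a random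
function indexed by `(τ, ω)`. -/
theorem measurable_gradient_step [MeasurableSpace M] [BorelSpace M] [SecondCountableTopology M]
    [TopologicalSpace.MetrizableSpace M] (hR : IsRetraction R)
    (hd : DifferentiableInM (m := m) f) (hm : ∀ x, Measurable (f x)) :
    Measurable fun p : (M × ℝ) × Ω =>
      R ⟨p.1.1, p.1.2 • rgrad (m := m) (fun y => f y p.2) p.1.1⟩ := by
  have h := measurable_retraction_rgrad (Ω := ℝ × Ω) (h := fun y q => q.1 * f y q.2) hR
    (fun q => (hd q.2).const_smul q.1)
    (fun x => measurable_fst.mul ((hm x).comp measurable_snd))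
  have h' := h.comp (f := fun p : (M × ℝ) × Ω => (p.1.1, (p.1.2, p.2))) (by fun_prop)
  refine Eq.mp (congrArg Measurable (funext fun p => ?_)) h'
  simp only [Function.comp, rgrad_const_mul p.1.2 (hd p.2 p.1.1)]

variable {S : Type*} {m0 : MeasurableSpace S} {φ : ℕ → S → ℝ} {ξ : ℕ → S → Ω} {x : ℕ → S → M}
  {c : ℕ → ℝ}

/-- The iterate `x_t` is a measurable function of the data available at step `t`. -/
theorem measurable_iterate [MeasurableSpace M] [BorelSpace M] [SecondCountableTopology M]
    [TopologicalSpace.MetrizableSpace M] (hR : IsRetraction R)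
    (hd : DifferentiableInM (m := m) f) (hm : ∀ x, Measurable (f x))
    (hφ : ∀ t, Measurable (φ t)) (hξ : ∀ t, Measurable (ξ t)) {x₀ : M} (hx0 : ∀ s, x 0 s = x₀)
    (hx : ∀ t s, x (t + 1) s = R ⟨x t s,
      -(c t / φ t s) • rgrad (m := m) (fun y => f y (ξ t s)) (x t s)⟩) (t : ℕ) :
    Measurable[pastFiltration φ ξ hφ hξ t] (x t) := by
  induction t with
  | zero =>
    rw [show x 0 = fun _ => x₀ from funext hx0]
    exact measurable_const
  | succ t ih =>
    have h1 : Measurable[pastFiltration φ ξ hφ hξ (t + 1)] (x t) :=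
      ih.mono ((pastFiltration φ ξ hφ hξ).mono (Nat.le_succ t)) le_rfl
    have h2 : Measurable[pastFiltration φ ξ hφ hξ (t + 1)] (φ t) :=
      measurable_factor_pastData (Nat.le_succ t)
    have h3 : Measurable[pastFiltration φ ξ hφ hξ (t + 1)] (ξ t) :=
      measurable_sample_pastData (Nat.lt_succ_self t)
    have h4 : Measurable[pastFiltration φ ξ hφ hξ (t + 1)] fun s => -(c t / φ t s) :=
      (measurable_const.div h2).neg
    have h5 := (measurable_gradient_step hR hd hm).comp ((h1.prodMk h4).prodMk h3)
    rw [show x (t + 1) = _ from funext (hx t)]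
    exact h5

variable {P : Measure S}

theorem indep_past_sample (hφ : ∀ t, Measurable (φ t)) (hξ : ∀ t, Measurable (ξ t)) {t : ℕ}
    (h : IndepFun
      (fun s => ((fun i : Set.Iic t => φ (i : ℕ) s), (fun i : Set.Iio t => ξ (i : ℕ) s)))
      (fun s => (fun j : Set.Ici t => ξ (j : ℕ) s)) P) :
    Indep (pastFiltration φ ξ hφ hξ t) (MeasurableSpace.comap (ξ t) inferInstance) P :=
  (IndepFun_iff_Indep (pastData φ ξ t) (ξ t) P).1
    (h.comp measurable_id (measurable_pi_apply (⟨t, le_refl t⟩ : Set.Ici t)))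

variable [IsProbabilityMeasure P] {μ : Measure Ω} [IsProbabilityMeasure μ] {F : M → ℝ}

/-- Uniform first-order bounds for gradient steps from a compact set. -/
theorem gradient_step_bounds (hR : IsRetraction R) (hm : ∀ x, Measurable (f x))
    (hd : DifferentiableInM (m := m) f) (hb : LocallyBounded f)
    (hg : LocallyBounded (fun x ξ => ‖rgrad (m := m) (fun y => f y ξ) x‖))
    (hlip : LocallyRLipschitzGradient R f) (hF : ∀ x, F x = ∫ ξ, f x ξ ∂μ)
    {K : Set M} (hK : IsCompact K) {r : ℝ} (hr : 0 < r) :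
    ∃ A > 0, ∃ B > 0, ∀ y ∈ K, |F y| ≤ A ∧
      (∀ ω', ‖rgrad (m := m) (fun z => f z ω') y‖ ≤ A) ∧
      ∀ τ, 0 ≤ τ → τ ≤ r →
        (∀ ω', |F (R ⟨y, -τ • rgrad (m := m) (fun z => f z ω') y⟩) - F y| ≤ B * τ) ∧
        (∀ ω', F (R ⟨y, -τ • rgrad (m := m) (fun z => f z ω') y⟩) - F y
          ≤ -(τ * differential (m := m) (fun z => f z ω') y (rgrad (m := m) F y)) + B * τ ^ 2) := by
  obtain ⟨A₁, hA₁, h1⟩ := hb K hK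
  obtain ⟨A₂, hA₂, h2⟩ := hg K hK
  obtain ⟨A₃, h3⟩ := hK.exists_bound_of_continuousOn
    (continuous_norm_rgrad_mean hR hm hd hb hg hlip hF).continuousOn
  obtain ⟨C, hC, h4⟩ := mean_expansion hR hm hd hb hg hlip hF hK (r := r * A₂) (by positivity)
  have hA₃ : ∀ y ∈ K, ‖rgrad (m := m) F y‖ ≤ |A₃| := fun y hy =>
    (norm_norm (rgrad (m := m) F y)).ge.trans ((h3 y hy).trans (le_abs_self _))
  -- The first two summands bound the increment linearly in `τ`, using `τ² ≤ r τ`; the last bounds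
  -- the quadratic remainder.
  refine ⟨max A₁ A₂, lt_max_of_lt_left hA₁, |A₃| * A₂ + C * A₂ ^ 2 * r + C * A₂ ^ 2,
    by positivity, fun y hy => ⟨?_, fun ω' => ?_, fun τ hτ hτr => ?_⟩⟩
  · rw [hF, ← Real.norm_eq_abs]
    have := norm_integral_le_of_norm_le_const (μ := μ) (f := fun ω' => f y ω')
      (ae_of_all _ fun ω' => h1 y hy ω')
    simp only [probReal_univ, mul_one] at this
    exact this.trans (le_max_left _ _)
  · have := h2 y hy ω'
    rw [abs_of_nonneg (norm_nonneg _)] at this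
    exact this.trans (le_max_right _ _)
  · have hgr : ∀ ω', ‖rgrad (m := m) (fun z => f z ω') y‖ ≤ A₂ := fun ω' => by
      have := h2 y hy ω'
      rwa [abs_of_nonneg (norm_nonneg _)] at this
    have hv : ∀ ω', ‖-τ • rgrad (m := m) (fun z => f z ω') y‖ ≤ τ * A₂ := fun ω' => by
      rw [norm_smul, norm_neg, Real.norm_eq_abs, abs_of_nonneg hτ]
      exact mul_le_mul_of_nonneg_left (hgr ω') hτ
    have hexp : ∀ ω', |F (R ⟨y, -τ • rgrad (m := m) (fun z => f z ω') y⟩) - F y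
        + τ * differential (m := m) (fun z => f z ω') y (rgrad (m := m) F y)|
          ≤ C * A₂ ^ 2 * τ ^ 2 := fun ω' => by
      have := h4 y hy _ ((hv ω').trans (by gcongr))
      -- Symmetry of the metric turns `dF(∇f_ω)` into `df_ω(∇F)`, whose mean over `ω` is computed by
      -- the mean differential at a fixed vector.
      rw [map_smul, ← inner_rgrad, real_inner_comm, inner_rgrad, smul_eq_mul] at this
      rw [neg_mul, sub_neg_eq_add] at this
      refine this.trans ?_
      have h5 := pow_le_pow_left₀ (norm_nonneg _) (hv ω') 2
      calc C * ‖-τ • rgrad (m := m) (fun z => f z ω') y‖ ^ 2 ≤ C * (τ * A₂) ^ 2 := by gcongr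
        _ = C * A₂ ^ 2 * τ ^ 2 := by ring
    have hdf : ∀ ω', |differential (m := m) (fun z => f z ω') y (rgrad (m := m) F y)|
        ≤ |A₃| * A₂ := fun ω' => by
      rw [← inner_rgrad]
      refine (abs_real_inner_le_norm _ _).trans ?_
      rw [mul_comm]
      exact mul_le_mul (hA₃ y hy) (hgr ω') (norm_nonneg _) (abs_nonneg _)
    have hτ2 : C * A₂ ^ 2 * τ ^ 2 ≤ C * A₂ ^ 2 * r * τ := by
      have : τ ^ 2 ≤ r * τ := by nlinarith
      calc C * A₂ ^ 2 * τ ^ 2 ≤ C * A₂ ^ 2 * (r * τ) := by gcongr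
        _ = _ := by ring
    have hp : 0 ≤ C * A₂ ^ 2 := by positivity
    refine ⟨fun ω' => ?_, fun ω' => ?_⟩
    · have e1 := abs_le.1 (hexp ω')
      have e2 := abs_le.1 (hdf ω')
      have e3 := mul_le_mul_of_nonneg_left e2.1 hτ
      have e4 := mul_le_mul_of_nonneg_left e2.2 hτ
      have e5 := mul_nonneg hp hτ
      rw [abs_le]
      constructor <;> nlinarith
    · have e1 := (abs_le.1 (hexp ω')).2
      have e2 : 0 ≤ (|A₃| * A₂ + C * A₂ ^ 2 * r) * τ ^ 2 := by positivity
      nlinarith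

/-- Almost sure convergence of the values and summability of the squared gradients along the
iteration. -/
theorem ae_tendsto_and_summable_iterates [T2Space M] [SigmaCompactSpace M] (hR : IsRetraction R)
    (hm : ∀ x, Measurable (f x))
    (hd : DifferentiableInM (m := m) f) (hb : LocallyBounded f)
    (hg : LocallyBounded (fun x ξ => ‖rgrad (m := m) (fun y => f y ξ) x‖))
    (hlip : LocallyRLipschitzGradient R f) (hF : ∀ x, F x = ∫ ξ, f x ξ ∂μ)
    {K : Set M} (hK : IsCompact K) (hxK : ∀ t s, x t s ∈ K)
    (hφ : ∀ t, Measurable (φ t)) (hξ : ∀ t, Measurable (ξ t)) (hlaw : ∀ t, P.map (ξ t) = μ)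
    {x₀ : M} (hx0 : ∀ s, x 0 s = x₀)
    (hx : ∀ t s, x (t + 1) s = R ⟨x t s,
      -(c t / φ t s) • rgrad (m := m) (fun y => f y (ξ t s)) (x t s)⟩)
    (hc : ∀ t, 0 < c t) (hc_sq : Summable fun t => c t ^ 2)
    (hind : ∀ t : ℕ, IndepFun
        (fun s => ((fun i : Set.Iic t => φ (i : ℕ) s), (fun i : Set.Iio t => ξ (i : ℕ) s)))
        (fun s => (fun j : Set.Ici t => ξ (j : ℕ) s)) P)
    {Φmin Φmax : ℝ} (hmin : 0 < Φmin) (hφb : ∀ t s, Φmin ≤ φ t s ∧ φ t s ≤ Φmax) :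
    ∀ᵐ s ∂P, (∃ L, Tendsto (fun t => F (x t s)) atTop (𝓝 L)) ∧
      Summable fun t => c t * ‖rgrad (m := m) F (x t s)‖ ^ 2 := by
  let _ : MeasurableSpace M := borel M
  have : BorelSpace M := ⟨rfl⟩
  have : SecondCountableTopology M :=
    ChartedSpace.secondCountable_of_sigmaCompact (EuclideanSpace ℝ (Fin m)) M
  have : TopologicalSpace.MetrizableSpace M := Manifold.metrizableSpace (𝓡 m) M
  have hbdd : ∀ t, c t ≤ √(∑' t, c t ^ 2) := fun t =>
    Real.le_sqrt_of_sq_le (hc_sq.le_tsum t fun _ _ => sq_nonneg _)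
  obtain ⟨A, hA, B, hB, H⟩ := gradient_step_bounds hR hm hd hb hg hlip hF hK
    (r := √(∑' t, c t ^ 2) / Φmin) (div_pos ((hc 0).trans_le (hbdd 0)) hmin)
  have hφ0 : ∀ t s, 0 < φ t s := fun t s => hmin.trans_le (hφb t s).1
  have hτ0 : ∀ t s, 0 ≤ c t / φ t s := fun t s => (div_pos (hc t) (hφ0 t s)).le
  have hτ : ∀ t s, c t / φ t s ≤ c t / Φmin := fun t s =>
    div_le_div_of_nonneg_left (hc t).le hmin (hφb t s).1
  have hτr : ∀ t s, c t / φ t s ≤ √(∑' t, c t ^ 2) / Φmin := fun t s =>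
    (hτ t s).trans (div_le_div_of_nonneg_right (hbdd t) hmin.le)
  have hFd := mdifferentiable_mean hR hm hd hb hg hlip hF
  have hxm := fun t => measurable_iterate hR hd hm hφ hξ hx0 hx t
  have hdrift : ∀ t, ∀ᵐ s ∂P, (P[(fun s => F (x (t + 1) s)) - (fun s => F (x t s)) |
      pastFiltration φ ξ hφ hξ t]) s
        ≤ -(c t / φ t s * ‖rgrad (m := m) F (x t s)‖ ^ 2) + B⁻¹ * (B / Φmin * c t) ^ 2 := by
    intro t
    have hΨ : Measurable fun p : (M × ℝ) × Ω =>
        F (R ⟨p.1.1, p.1.2 • rgrad (m := m) (fun y => f y p.2) p.1.1⟩) - F p.1.1 :=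
      (hFd.continuous.measurable.comp (measurable_gradient_step hR hd hm)).sub
        (hFd.continuous.measurable.comp (measurable_fst.comp measurable_fst))
    -- The past at step `t` includes `φ_t` itself, so the step size is known and only `ξ_t` is
    -- averaged.
    have hz : Measurable[pastFiltration φ ξ hφ hξ t] fun s => (x t s, -(c t / φ t s)) :=
      (hxm t).prodMk ((measurable_const.div (measurable_factor_pastData le_rfl)).neg)
    have hΨb : ∀ s ω', |F (R ⟨x t s, -(c t / φ t s) • rgrad (m := m) (fun y => f y ω') (x t s)⟩)
        - F (x t s)| ≤ B * (c t / Φmin) := fun s ω' =>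
      (((H _ (hxK t s)).2.2 _ (hτ0 t s) (hτr t s)).1 ω').trans
        (mul_le_mul_of_nonneg_left (hτ t s) hB.le)
    have key := condExp_of_indep ((pastFiltration φ ξ hφ hξ).le t) (hξ t) hz
      (indep_past_sample hφ hξ (hind t)) hΨ hΨb
    have e : (fun s => F (x (t + 1) s)) - (fun s => F (x t s)) = fun s =>
        F (R ⟨x t s, -(c t / φ t s) • rgrad (m := m) (fun y => f y (ξ t s)) (x t s)⟩)
          - F (x t s) := by
      funext s
      rw [Pi.sub_apply, hx t s]
    rw [e]
    filter_upwards [key] with s hs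
    rw [hs, hlaw]
    obtain ⟨-, hmean⟩ := differential_mean_apply hR hm hd hb hg hlip hF (x t s)
    obtain ⟨hi, he⟩ := hmean (rgrad (m := m) F (x t s))
    -- Testing the mean differential against `∇F` itself produces `‖∇F‖²`.
    rw [← inner_rgrad, real_inner_self_eq_norm_sq] at he
    have hi1 : Integrable (fun ω' => -(c t / φ t s * differential (m := m) (fun z => f z ω') (x t s)
        (rgrad (m := m) F (x t s)))) μ := (hi.const_mul _).neg
    have hi2 : Integrable (fun ω' => F (R ⟨x t s,
        -(c t / φ t s) • rgrad (m := m) (fun y => f y ω') (x t s)⟩) - F (x t s)) μ := by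
      refine Integrable.of_bound (Measurable.aestronglyMeasurable ?_) _
        (ae_of_all _ fun ω' => hΨb s ω')
      exact hΨ.comp (measurable_prodMk_left (x := (x t s, -(c t / φ t s))))
    calc ∫ ω', (F (R ⟨x t s, -(c t / φ t s) • rgrad (m := m) (fun y => f y ω') (x t s)⟩)
          - F (x t s)) ∂μ
        ≤ ∫ ω', (-(c t / φ t s * differential (m := m) (fun z => f z ω') (x t s)
          (rgrad (m := m) F (x t s))) + B * (c t / φ t s) ^ 2) ∂μ :=
          integral_mono hi2 (hi1.add (integrable_const _))
            fun ω' => ((H _ (hxK t s)).2.2 _ (hτ0 t s) (hτr t s)).2 ω'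
      _ = -(c t / φ t s * ‖rgrad (m := m) F (x t s)‖ ^ 2) + B * (c t / φ t s) ^ 2 := by
          rw [integral_add hi1 (integrable_const _), integral_neg, integral_const_mul, he]
          simp
      _ ≤ _ := by
          have h1 := pow_le_pow_left₀ (hτ0 t s) (hτ t s) 2
          -- The sequence `B c_t / Φmin` bounds the increments; the constant `B⁻¹` rewrites the
          -- drift error as a multiple of its square.
          have h2 : B⁻¹ * (B / Φmin * c t) ^ 2 = B * (c t / Φmin) ^ 2 := by field_simp
          rw [h2]
          gcongr
  have hadapt : StronglyAdapted (pastFiltration φ ξ hφ hξ) fun t s => F (x t s) := fun t =>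
    (hFd.continuous.measurable.comp (hxm t)).stronglyMeasurable
  have hinc : ∀ t s, |F (x (t + 1) s) - F (x t s)| ≤ B / Φmin * c t := fun t s => by
    rw [hx t s]
    refine (((H _ (hxK t s)).2.2 _ (hτ0 t s) (hτr t s)).1 (ξ t s)).trans ?_
    refine (mul_le_mul_of_nonneg_left (hτ t s) hB.le).trans_eq (by ring)
  have hconv := ae_tendsto_and_summable_of_condExp_drift (P := P) hadapt
    (fun t s => (H _ (hxK t s)).1) hinc
    (by simpa [mul_pow] using hc_sq.mul_left ((B / Φmin) ^ 2))
    (fun t s => mul_nonneg (hτ0 t s) (sq_nonneg ‖rgrad (m := m) F (x t s)‖))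
    (inv_nonneg.2 hB.le) hdrift
  filter_upwards [hconv] with s hs
  refine ⟨hs.1, Summable.of_nonneg_of_le (fun t => mul_nonneg (hc t).le (sq_nonneg _))
    (fun t => ?_) (hs.2.mul_left Φmax)⟩
  -- The upper bound on `φ` replaces the random weights `c_t / φ_t` by `c_t`.
  have h1 : c t ≤ Φmax * (c t / φ t s) := by
    rw [← mul_div_assoc, le_div_iff₀ (hφ0 t s), mul_comm]
    exact mul_le_mul_of_nonneg_right (hφb t s).2 (hc t).le
  rw [← mul_assoc]
  exact mul_le_mul_of_nonneg_right h1 (sq_nonneg _)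

end Iteration

end ConfinedSGD

/-! ### Assembly of the theorem. -/

theorem theorem2p1
    {m : ℕ} {M : Type*} [TopologicalSpace M] [T2Space M]
    [ChartedSpace (EuclideanSpace ℝ (Fin m)) M] [IsManifold (𝓡 m) ∞ M]
    [RiemannianBundle (fun x : M => TangentSpace (𝓡 m) x)]
    [IsContMDiffRiemannianBundle (𝓡 m) ∞ (EuclideanSpace ℝ (Fin m))
      (fun x : M => TangentSpace (𝓡 m) x)]
    -- the retraction
    (R : TangentBundle (𝓡 m) M → M) (hR : ConfinedSGD.IsRetraction R)
    (hR2 : ContMDiff (𝓡 m).tangent (𝓡 m) 2 R)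
    -- the random function
    {Ω : Type*} [MeasurableSpace Ω] (μ : Measure Ω) [IsProbabilityMeasure μ]
    (f : M → Ω → ℝ) (hf_meas : ∀ x, Measurable (f x))
    (hf_diff : ConfinedSGD.DifferentiableInM (m := m) f)
    (hf_bdd : ConfinedSGD.LocallyBounded f)
    (hf_grad_bdd : ConfinedSGD.LocallyBounded
      (fun x ξ => ‖ConfinedSGD.rgrad (m := m) (fun y => f y ξ) x‖))
    (hf_lip : ConfinedSGD.LocallyRLipschitzGradient R f)
    (F : M → ℝ) (hF : ∀ x, F x = ∫ ξ, f x ξ ∂μ)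
    -- the confinement
    (ρ : M → ℝ) (hρ : ConfinedSGD.IsConfinement (m := m) f ρ)
    (hρ2 : ContMDiff (𝓡 m) 𝓘(ℝ, ℝ) 2 ρ)
    (ρ₀ : ℝ) (hρ₀ : ConfinedSGD.GradientsAlignedAbove (m := m) f ρ ρ₀)
    -- the independent samples
    {S : Type*} [MeasurableSpace S] (P : Measure S) [IsProbabilityMeasure P]
    (ξ : ℕ → S → Ω) (hξ_meas : ∀ t, Measurable (ξ t))
    (hξ_indep : iIndepFun ξ P) (hξ_law : ∀ t, P.map (ξ t) = μ)
    -- the parameters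
    (a b Θ : ℝ) (ha : 0 < a) (hb : 0 < b) (hΘ : 0 < Θ)
    (c : ℕ → ℝ) (hc_pos : ∀ t, 0 < c t)
    (hc_sum : Tendsto (fun n => ∑ t ∈ Finset.range n, c t) atTop atTop)
    (hc_sq : Summable (fun t => c t ^ 2))
    (ρ₁ : ℝ) (hρ₁ : ρ₁ = ρ₀ + (⨆ t, c t) * a + b ^ 2 * (∑' t, c t ^ 2) / 2)
    (x₀ : M) (hx₀ : ρ x₀ ≤ ρ₀)
    -- the iterates and the step-size factors
    (x : ℕ → S → M) (φ : ℕ → S → ℝ) (hφ_meas : ∀ t, Measurable (φ t))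
    (hx_zero : ∀ s, x 0 s = x₀)
    (hx_succ : ∀ t s, x (t + 1) s = R ⟨x t s,
      -(c t / φ t s) • ConfinedSGD.rgrad (m := m) (fun y => f y (ξ t s)) (x t s)⟩)
    (hφ : ∀ t s, max (max (ConfinedSGD.stepBoundA (m := m) f ρ a (x t s))
      (ConfinedSGD.stepBoundB R f ρ b Θ (x t s))) (c t / Θ) ≤ φ t s) :
    (IsCompact {y : M | ρ y ≤ ρ₁} ∧
      (∀ s t, x t s ∈ {y : M | ρ y ≤ ρ₁}) ∧
      ∀ s, ∃ (k : ℕ → ℕ) (y : M), StrictMono k ∧ Tendsto (fun n => x (k n) s) atTop (𝓝 y)) ∧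
    -- non-anticipation: what is known when step `t` is taken is independent of `ξ_t, ξ_{t+1}, …`
    ((∀ t : ℕ, IndepFun
        (fun s => ((fun i : Set.Iic t => φ (i : ℕ) s), (fun i : Set.Iio t => ξ (i : ℕ) s)))
        (fun s => (fun j : Set.Ici t => ξ (j : ℕ) s)) P) →
      (∃ Φmin Φmax : ℝ, 0 < Φmin ∧ 0 < Φmax ∧ ∀ t s, Φmin ≤ φ t s ∧ φ t s ≤ Φmax) →
      (∀ y, Integrable (f y) μ) ∧ MDifferentiable (𝓡 m) 𝓘(ℝ, ℝ) F ∧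
      (∀ᵐ s ∂P, ∃ L : ℝ, Tendsto (fun t => F (x t s)) atTop (𝓝 L)) ∧
      (∀ᵐ s ∂P, Tendsto (fun t => ‖ConfinedSGD.rgrad (m := m) F (x t s)‖) atTop (𝓝 0)) ∧
      (∀ᵐ s ∂P, ∀ y : M, MapClusterPt y atTop (fun t => x t s) →
        ConfinedSGD.IsStationary (m := m) F y)) := by
  have hcont : IsContinuousRiemannianBundle (EuclideanSpace ℝ (Fin m))
      (fun x : M => TangentSpace (𝓡 m) x) := by
    obtain ⟨g, hg, h⟩ := IsContMDiffRiemannianBundle.exists_contMDiff (IB := 𝓡 m) (n := ∞)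
      (F := EuclideanSpace ℝ (Fin m)) (E := fun x : M => TangentSpace (𝓡 m) x)
    exact ⟨g, hg.continuous, h⟩
  -- The compact sublevel sets of `ρ` exhaust `M`; with the charts this yields second countability.
  have hσ : SigmaCompactSpace M :=
    ⟨⟨fun n => {y | ρ y ≤ n}, fun n => hρ.isCompact_sublevel n,
      Set.eq_univ_of_forall fun y => Set.mem_iUnion.2 (exists_nat_ge (ρ y))⟩⟩
  have : SecondCountableTopology M :=
    ChartedSpace.secondCountable_of_sigmaCompact (EuclideanSpace ℝ (Fin m)) M
  have hK : IsCompact {y : M | ρ y ≤ ρ₁} := hρ.isCompact_sublevel ρ₁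
  have hxK : ∀ s t, x t s ∈ {y : M | ρ y ≤ ρ₁} := fun s t => by
    rw [Set.mem_ofPred_eq, hρ₁]
    exact ConfinedSGD.confinement_iterates ha hb hΘ hR hR2 hρ2 hf_grad_bdd hρ₀ hc_pos hc_sq
      (x := fun t => x t s) (φ := fun t => φ t s) (ξ := fun t => ξ t s)
      (by simpa only [hx_zero s] using hx₀) (fun t => hx_succ t s) (fun t => hφ t s) t
  refine ⟨⟨hK, hxK, fun s => ?_⟩, fun hind ⟨Φmin, Φmax, hmin, _, hφb⟩ => ?_⟩
  · obtain ⟨y, -, k, hk, hy⟩ := hK.tendsto_subseq (hxK s)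
    exact ⟨k, y, hk, hy⟩
  have hFd := ConfinedSGD.mdifferentiable_mean hR hf_meas hf_diff hf_bdd hf_grad_bdd hf_lip hF
  have hgc := ConfinedSGD.continuous_norm_rgrad_mean hR hf_meas hf_diff hf_bdd hf_grad_bdd
    hf_lip hF
  have hae := ConfinedSGD.ae_tendsto_and_summable_iterates (P := P) hR hf_meas hf_diff hf_bdd
    hf_grad_bdd hf_lip hF hK (fun t s => hxK s t) hφ_meas hξ_meas hξ_law hx_zero hx_succ
    hc_pos hc_sq hind hmin hφb
  have hc0 : Tendsto c atTop (𝓝 0) := by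
    have := hc_sq.tendsto_atTop_zero.sqrt
    simpa only [Real.sqrt_sq (hc_pos _).le, Real.sqrt_zero] using this
  obtain ⟨D, hD, hgD⟩ := hf_grad_bdd _ hK
  have hstep : ∀ s t, ‖-(c t / φ t s) • ConfinedSGD.rgrad (m := m) (fun y => f y (ξ t s))
      (x t s)‖ ≤ D / Φmin * c t := fun s t => by
    have hφ0 : 0 < φ t s := hmin.trans_le (hφb t s).1
    have h1 : c t / φ t s ≤ c t / Φmin :=
      div_le_div_of_nonneg_left (hc_pos t).le hmin (hφb t s).1
    have h2 := (le_abs_self _).trans (hgD _ (hxK s t) (ξ t s))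
    rw [norm_smul, norm_neg, Real.norm_of_nonneg (div_pos (hc_pos t) hφ0).le]
    calc _ ≤ c t / Φmin * D :=
          mul_le_mul h1 h2 (norm_nonneg _) (div_pos (hc_pos t) hmin).le
      _ = D / Φmin * c t := by ring
  have hstat : ∀ᵐ s ∂P, ∀ y : M, MapClusterPt y atTop (fun t => x t s) →
      ‖ConfinedSGD.rgrad (m := m) F y‖ = 0 := by
    filter_upwards [hae] with s hs y hy
    exact ConfinedSGD.eq_zero_of_mapClusterPt hR hK (hxK s) (fun t => hx_succ t s) hc_pos hc_sum
      hc0 (hstep s) hgc (fun _ => norm_nonneg _) hs.2 hy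
  refine ⟨ConfinedSGD.integrable_of_locallyBounded hf_meas hf_bdd, hFd,
    hae.mono fun s hs => hs.1, hstat.mono fun s hs => ?_,
    hstat.mono fun s hs y hy => ⟨hFd y, norm_eq_zero.1 (hs y hy)⟩⟩
  exact ConfinedSGD.tendsto_zero_of_mapClusterPt hK (hxK s) hgc hs
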